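/- **Setting.** Let $\Bbbk$ be an algebraically closed field of characteristic $0$ and let $n\ge 1$. Let $A=A_n$ be the $\Bbbk$-algebra with basis $e_0,\ e_i,\ a_i,\ b_i\ (1\le i\le n),\ c$, where $e_0,\dots,e_n$ are orthogonal idempotents with sum $1$, $a_i\in e_iAe_0$, $b_i\in e_0Ae_i$, $c\in e_0Ae_0$, $b_ia_i=c$ for all $i$, $a_ib_j=0$ for all $i,j$, and $c$ is annihilated on both sides by all $a_i,b_i,c$. Let $\mathscr B_n$ be the $\Bbbk$-linear bicategory with one object $\mathtt i$, with 1-morphisms the $A$-$A$-bimodules in $\operatorname{add}\{A,\ Ae_k\otimes_\Bbbk e_0A \mid 0\le k\le n\}$, with 2-morphisms the bimodule homomorphisms, and with composition $G\circ F=G\otimes_AF$. Let $[\mathscr B_n,\mathbf{Cat}_\Bbbk]_\Bbbk$ be the bicategory of $\Bbbk$-linear pseudofunctors from $\mathscr B_n$ to small $\Bbbk$-linear categories, strong transformations and modifications. In it consider * $\mathbf P=\mathscr B_n(\mathtt i,-)$, the sub-pseudofunctor $\mathbf N\subseteq\mathbf P$ on $\operatorname{add}\{Ae_k\otimes_\Bbbk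 e_0A\mid 0\le k\le n\}$, and the inclusion $\Gamma:\mathbf N\to\mathbf P$; * $\mathbf C$, the category $A\text{-proj}$ of finitely generated projective left $A$-modules, on which a bimodule $M$ acts by $M\otimes_A-$; * for $1\le j\le n$, the strong transformation $\Theta_j=-\otimes_AAe_j:\mathbf P\to\mathbf C$; * for $1\le j,l\le n$, the invertible modification $\mathsf s_{j,l}:\Theta_j\circ\Gamma\to\Theta_l\circ\Gamma$ whose component at $M\in\mathbf N(\mathtt i)$ is the unique map $s:M\otimes_AAe_j\to M\otimes_AAe_l$ with $(M\otimes(\cdot a_l))\circ s=M\otimes(\cdot a_j)$ as maps to $M\otimes_AAe_0$. Let $\mathfrak P$ be a set partition of $\{1,\dots,n\}$. Let $\Omega^{\mathtt W}(\mathfrak P):\mathbf C\to\mathbf C^{\mathtt W}(\mathfrak P)$, with invertible modifications $\widehat{\mathsf x}_{i,j}:\Omega^{\mathtt W}(\mathfrak P)\circ\Theta_i\to\Omega^{\mathtt W}(\mathfrak P)\circ\Theta_j$ for $i,j$ in the same block of $\mathfrak P$, satisfying $\widehat{\mathsf x}_{i,i}=\mathrm{id}$ and $\widehat{\mathsf x}_{j,l}\circ\widehat{\mathsf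 x}_{i,j}=\widehat{\mathsf x}_{i,l}$, be the universal such datum, i.e. the bicategorical colimit of $\Theta_1,\dots,\Theta_n$ weighted by the groupoid with object set $\{1,\dots,n\}$ and exactly one morphism $i\to j$ whenever $i,j$ lie in the same block. Let $\Omega^{\mathtt R}(\mathfrak P):\mathbf C^{\mathtt W}(\mathfrak P)\to\mathbf C^{\mathtt{WR}}(\mathfrak P)$ be the bicategorical coequifier of the pairs $\widehat{\mathsf x}_{i,j}\bullet\Gamma$, $\Omega^{\mathtt W}(\mathfrak P)\bullet\mathsf s_{i,j}$, for all $i,j$ in the same block of $\mathfrak P$, and put $\Omega^{\mathtt{WR}}(\mathfrak P)=\Omega^{\mathtt R}(\mathfrak P)\circ\Omega^{\mathtt W}(\mathfrak P):\mathbf C\to\mathbf C^{\mathtt{WR}}(\mathfrak P)$. **Proposition.** These colimits exist for every set partition $\mathfrak P$ of $\{1,\dots,n\}$. For every choice of them, there are strong transformations $\widetilde\Omega(\mathfrak P,\mathfrak P'):\mathbf C^{\mathtt{WR}}(\mathfrak P)\to\mathbf C^{\mathtt{WR}}(\mathfrak P')$, one for each pair of set partitions such that $\mathfrak P$ refines $\mathfrak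 P'$ (every block of $\mathfrak P$ is contained in a block of $\mathfrak P'$), such that $$\Omega^{\mathtt{WR}}(\mathfrak P')\simeq\widetilde\Omega(\mathfrak P,\mathfrak P')\circ\Omega^{\mathtt{WR}}(\mathfrak P)$$ whenever $\mathfrak P$ refines $\mathfrak P'$, and $$\widetilde\Omega(\mathfrak P,\mathfrak P'')\simeq\widetilde\Omega(\mathfrak P',\mathfrak P'')\circ\widetilde\Omega(\mathfrak P,\mathfrak P')$$ whenever $\mathfrak P$ refines $\mathfrak P'$ and $\mathfrak P'$ refines $\mathfrak P''$. Here $\simeq$ means isomorphic through an invertible modification. -/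

import Mathlib

open CategoryTheory Bicategory
open scoped Pseudofunctor.StrongTrans

universe u v w

namespace BiRep

/-! ### Linear bicategories -/

/-- A bicategory whose hom-categories are preadditive and whose horizontal composition is
biadditive. -/
class PreadditiveBicategory (𝔅 : Type*) [Bicategory 𝔅] where
  [homPreadditive : ∀ a b : 𝔅, Preadditive (a ⟶ b)]
  whiskerLeft_add : ∀ {a b c : 𝔅} (f : a ⟶ b) {g h : b ⟶ c} (η θ : g ⟶ h),
    f ◁ (η + θ) = f ◁ η + f ◁ θ
  add_whiskerRight : ∀ {a b c : 𝔅} {f g : a ⟶ b} (η θ : f ⟶ g) (h : b ⟶ c),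
    (η + θ) ▷ h = η ▷ h + θ ▷ h

attribute [reducible, instance] PreadditiveBicategory.homPreadditive

/-- A `k`-linear bicategory: the hom-categories are `k`-linear and horizontal composition is
`k`-bilinear. -/
class LinearBicategory (k : Type*) [Field k] (𝔅 : Type*) [Bicategory 𝔅]
    [PreadditiveBicategory 𝔅] where
  [homLinear : ∀ a b : 𝔅, Linear k (a ⟶ b)]
  whiskerLeft_smul : ∀ {a b c : 𝔅} (f : a ⟶ b) {g h : b ⟶ c} (r : k) (η : g ⟶ h),
    f ◁ (r • η) = r • (f ◁ η)
  smul_whiskerRight : ∀ {a b c : 𝔅} {f g : a ⟶ b} (r : k) (η : f ⟶ g) (h : b ⟶ c),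
    (r • η) ▷ h = r • (η ▷ h)

attribute [reducible, instance] LinearBicategory.homLinear

/-! ### The 2-category of small `k`-linear categories -/

/-- A `k`-linear category, small with respect to the universe `v`. -/
structure LinCat (k : Type u) [Field k] : Type (max u (v + 1)) where
  carrier : Type v
  [category : Category.{v} carrier]
  [preadditive : Preadditive carrier]
  [linear : Linear k carrier]

attribute [instance] LinCat.category LinCat.preadditive LinCat.linear

variable {k : Type u} [Field k]

/-- A `k`-linear functor. -/
structure LinFunctor (C D : LinCat.{u, v} k) where
  functor : C.carrier ⥤ D.carrier
  [additive : functor.Additive]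
  [linear : functor.Linear k]

attribute [instance] LinFunctor.additive LinFunctor.linear

/-- Natural transformations of `k`-linear functors. -/
@[ext]
structure LinFunctor.Hom {C D : LinCat.{u, v} k} (F G : LinFunctor C D) where
  nat : F.functor ⟶ G.functor

instance LinCat.categoryStruct : CategoryStruct (LinCat.{u, v} k) where
  Hom := LinFunctor
  id C := { functor := 𝟭 C.carrier }
  comp F G := { functor := F.functor ⋙ G.functor }

instance LinCat.homCategory (C D : LinCat.{u, v} k) : Category (C ⟶ D) where
  Hom F G := LinFunctor.Hom F G
  id F := ⟨𝟙 F.functor⟩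
  comp α β := ⟨α.nat ≫ β.nat⟩

@[ext]
lemma LinCat.hom_ext {C D : LinCat.{u, v} k} {F G : C ⟶ D} {α β : F ⟶ G}
    (h : ∀ X, α.nat.app X = β.nat.app X) : α = β :=
  LinFunctor.Hom.ext (NatTrans.ext (funext h))

section
variable {C D E : LinCat.{u, v} k}

@[simp] lemma LinCat.id_functor : LinFunctor.functor (𝟙 C) = 𝟭 C.carrier := rfl
@[simp] lemma LinCat.comp_functor (F : C ⟶ D) (G : D ⟶ E) :
    LinFunctor.functor (F ≫ G) = F.functor ⋙ G.functor := rfl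
@[simp] lemma LinCat.id_nat (F : C ⟶ D) : LinFunctor.Hom.nat (𝟙 F) = 𝟙 F.functor := rfl
@[simp] lemma LinCat.comp_nat {F G H : C ⟶ D} (α : F ⟶ G) (β : G ⟶ H) :
    LinFunctor.Hom.nat (α ≫ β) = α.nat ≫ β.nat := rfl

/-- A natural isomorphism as an invertible 2-morphism. -/
@[simps]
def LinCat.isoMk {F G : C ⟶ D} (α : F.functor ≅ G.functor) : F ≅ G where
  hom := ⟨α.hom⟩
  inv := ⟨α.inv⟩

end

@[simps! whiskerLeft_nat whiskerRight_nat associator_hom_nat associator_inv_nat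
  leftUnitor_hom_nat leftUnitor_inv_nat rightUnitor_hom_nat rightUnitor_inv_nat]
instance LinCat.bicategory : Bicategory (LinCat.{u, v} k) where
  homCategory := LinCat.homCategory
  whiskerLeft F G H α := LinFunctor.Hom.mk (F := F ≫ G) (G := F ≫ H)
    (Functor.whiskerLeft F.functor α.nat)
  whiskerRight {_ _ _ F G} α H := LinFunctor.Hom.mk (F := F ≫ H) (G := G ≫ H)
    (Functor.whiskerRight α.nat H.functor)
  associator F G H := LinCat.isoMk (F := (F ≫ G) ≫ H) (G := F ≫ G ≫ H)
    (Functor.associator F.functor G.functor H.functor)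
  leftUnitor {C _} F := LinCat.isoMk (F := 𝟙 C ≫ F) (G := F) F.functor.leftUnitor
  rightUnitor {_ D} F := LinCat.isoMk (F := F ≫ 𝟙 D) (G := F) F.functor.rightUnitor

/-- The bijection between 2-morphisms and natural transformations. -/
def LinFunctor.homEquiv {C D : LinCat.{u, v} k} (F G : C ⟶ D) :
    (F ⟶ G) ≃ (F.functor ⟶ G.functor) where
  toFun α := α.nat
  invFun α := ⟨α⟩

/-- Natural transformations of `k`-linear functors form a vector space, pointwise. -/
instance {C D : LinCat.{u, v} k} (F G : C ⟶ D) : AddCommGroup (F ⟶ G) :=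
  (LinFunctor.homEquiv F G).addCommGroup

instance {C D : LinCat.{u, v} k} (F G : C ⟶ D) : Module k (F ⟶ G) :=
  (LinFunctor.homEquiv F G).module k

@[simp] lemma LinCat.add_nat {C D : LinCat.{u, v} k} {F G : C ⟶ D} (α β : F ⟶ G) :
    LinFunctor.Hom.nat (α + β) = α.nat + β.nat := rfl
@[simp] lemma LinCat.smul_nat {C D : LinCat.{u, v} k} {F G : C ⟶ D} (r : k) (α : F ⟶ G) :
    LinFunctor.Hom.nat (r • α) = r • α.nat := rfl

/-! ### The bicategory of `k`-linear pseudofunctors -/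

/-- A `k`-linear pseudofunctor from a `k`-linear bicategory to the 2-category of small
`k`-linear categories. -/
structure LinPseudofunctor (k : Type u) [Field k] (𝔅 : Type*) [Bicategory 𝔅]
    [PreadditiveBicategory 𝔅] [LinearBicategory k 𝔅] where
  toPseudofunctor : 𝔅 ⥤ᵖ LinCat.{u, v} k
  map₂_add : ∀ {a b : 𝔅} {f g : a ⟶ b} (η θ : f ⟶ g),
    toPseudofunctor.map₂ (η + θ) = toPseudofunctor.map₂ η + toPseudofunctor.map₂ θ
  map₂_smul : ∀ {a b : 𝔅} {f g : a ⟶ b} (r : k) (η : f ⟶ g),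
    toPseudofunctor.map₂ (r • η) = r • toPseudofunctor.map₂ η

/-- The bicategory of `k`-linear pseudofunctors, strong transformations and modifications. -/
abbrev LinRep (k : Type u) [Field k] (𝔅 : Type*) [Bicategory 𝔅]
    [PreadditiveBicategory 𝔅] [LinearBicategory k 𝔅] :=
  InducedBicategory (𝔅 ⥤ᵖ LinCat.{u, v} k)
    (LinPseudofunctor.toPseudofunctor (k := k) (𝔅 := 𝔅))

/-! ### Bicategorical colimits -/

section Colimits

variable {𝒦 : Type*} [Bicategory 𝒦]

/-- Let `f i : a ⟶ b` be parallel 1-morphisms and let `r` be an equivalence relation on the index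
set. A cocone with vertex `c` for the weight given by the groupoid with exactly one
morphism `i ⟶ j` whenever `r i j`: a 1-morphism `leg : b ⟶ c` with invertible
2-morphisms `f i ≫ leg ≅ f j ≫ leg`, functorial in the morphisms `i ⟶ j` of that groupoid. -/
structure IsoCocone {a b : 𝒦} {ι : Type*} (f : ι → (a ⟶ b)) (r : Setoid ι) (c : 𝒦) where
  leg : b ⟶ c
  iso : ∀ {i j : ι}, r i j → (f i ≫ leg ≅ f j ≫ leg)
  iso_refl : ∀ i : ι, iso (r.refl i) = Iso.refl _
  iso_trans : ∀ {i j l : ι} (h : r i j) (h' : r j l),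
    iso (r.trans h h') = iso h ≪≫ iso h'

namespace IsoCocone

variable {a b : 𝒦} {ι : Type*} {f : ι → (a ⟶ b)} {r : Setoid ι}

/-- Morphisms of cocones with a fixed vertex: 2-morphisms compatible with the isomorphisms. -/
@[ext]
structure Hom {c : 𝒦} (x y : IsoCocone f r c) where
  hom : x.leg ⟶ y.leg
  comm : ∀ {i j : ι} (h : r i j),
    (x.iso h).hom ≫ f j ◁ hom = f i ◁ hom ≫ (y.iso h).hom

instance (c : 𝒦) : Category (IsoCocone f r c) where
  Hom x y := Hom x y
  id x := ⟨𝟙 _, by simp⟩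
  comp α β := ⟨α.hom ≫ β.hom, fun h => by
    simp only [Bicategory.whiskerLeft_comp, Category.assoc]
    rw [← β.comm, ← Category.assoc, α.comm, Category.assoc]⟩
  id_comp _ := Hom.ext (Category.id_comp _)
  comp_id _ := Hom.ext (Category.comp_id _)
  assoc _ _ _ := Hom.ext (Category.assoc _ _ _)

@[ext]
lemma hom_ext {c : 𝒦} {x y : IsoCocone f r c} {α β : x ⟶ y} (h : α.hom = β.hom) : α = β :=
  Hom.ext h

/-- Postcomposition of a cocone with a 1-morphism out of its vertex. -/
@[simps]
def postcomp {c d : 𝒦} (x : IsoCocone f r c) (g : c ⟶ d) : IsoCocone f r d where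
  leg := x.leg ≫ g
  iso {i j} h := (α_ (f i) x.leg g).symm ≪≫ whiskerRightIso (x.iso h) g ≪≫ α_ (f j) x.leg g
  iso_refl i := by ext; simp [x.iso_refl]
  iso_trans h h' := by ext; rw [x.iso_trans h h']; simp

/-- The comparison functor from 1-morphisms out of the vertex of a cocone to cocones. -/
@[simps]
def comparison {c : 𝒦} (x : IsoCocone f r c) (d : 𝒦) : (c ⟶ d) ⥤ IsoCocone f r d where
  obj g := x.postcomp g
  map {g g'} α := ⟨x.leg ◁ α, fun {i j} h => by
    dsimp only [postcomp, Iso.trans_hom, Iso.symm_hom]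
    rw [whiskerRightIso_hom, whiskerRightIso_hom]
    simp only [Category.assoc]
    rw [← associator_naturality_right, ← whisker_exchange_assoc,
      associator_inv_naturality_right_assoc]⟩
  map_id g := by ext; exact Bicategory.whiskerLeft_id _ _
  map_comp α β := by ext; exact Bicategory.whiskerLeft_comp _ _ _

/-- The cocone `x` exhibits its vertex as the bicategorical colimit (the iterated coisoinserter):
the comparison functors are equivalences of categories. -/
def IsBicolimit {c : 𝒦} (x : IsoCocone f r c) : Prop :=
  ∀ d : 𝒦, (x.comparison d).IsEquivalence

end IsoCocone

section Coequifier

variable {ι : Type*} {a : ι → 𝒦} {b : 𝒦} {f g : ∀ i, a i ⟶ b}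

/-- The 1-morphisms `h : b ⟶ c` that coequify the parallel 2-morphisms `α i, β i : f i ⟶ g i`. -/
def Coequifies (α β : ∀ i, f i ⟶ g i) (c : 𝒦) : ObjectProperty (b ⟶ c) :=
  fun h => ∀ i, α i ▷ h = β i ▷ h

lemma Coequifies.comp {α β : ∀ i, f i ⟶ g i} {c d : 𝒦} {h : b ⟶ c} (hh : Coequifies α β c h)
    (l : c ⟶ d) : Coequifies α β d (h ≫ l) := fun i => by
  rw [whiskerRight_comp, whiskerRight_comp, hh i]

/-- Precomposition with a coequifying 1-morphism. -/
def coequifierComparison {α β : ∀ i, f i ⟶ g i} {c : 𝒦} (h : b ⟶ c) (hh : Coequifies α β c h)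
    (d : 𝒦) : (c ⟶ d) ⥤ (Coequifies α β d).FullSubcategory :=
  (Coequifies α β d).lift ((Bicategory.precomp d h)) (fun l => hh.comp l)

/-- The 1-morphism `h` is the bicategorical (multiple) coequifier of the given pairs:
it coequifies them, and precomposition with it is an equivalence onto the category of
coequifying 1-morphisms. -/
structure IsCoequifier (α β : ∀ i, f i ⟶ g i) {c : 𝒦} (h : b ⟶ c) : Prop where
  coequifies : Coequifies α β c h
  isEquivalence : ∀ d : 𝒦, (coequifierComparison h coequifies d).IsEquivalence

end Coequifier

end Colimits

/-! ### Additive closures and full subcategories -/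

/-- `add {X i}`: the objects that are isomorphic to direct summands of finite direct sums of the
objects `X i`, that is, whose identity is a finite sum of endomorphisms factoring through some
`X i`. -/
def addClosure {C : Type*} [Category C] [Preadditive C] {ι : Type*} (X : ι → C) :
    ObjectProperty C :=
  fun M => ∃ (m : ℕ) (i : Fin m → ι) (p : ∀ t, M ⟶ X (i t)) (q : ∀ t, X (i t) ⟶ M),
    ∑ t, p t ≫ q t = 𝟙 M

section addClosure

variable {C : Type*} [Category C] [Preadditive C] {ι : Type*} {X : ι → C}

lemma addClosure.of_fintype {M : C} {σ : Type*} [Fintype σ] (i : σ → ι) (p : ∀ t, M ⟶ X (i t))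
    (q : ∀ t, X (i t) ⟶ M) (h : ∑ t, p t ≫ q t = 𝟙 M) : addClosure X M := by
  classical
  let e := Fintype.equivFin σ
  refine ⟨Fintype.card σ, fun t => i (e.symm t), fun t => p _, fun t => q _, ?_⟩
  rw [← h]
  exact Equiv.sum_comp e.symm (fun t => p t ≫ q t)

lemma addClosure.self (i : ι) : addClosure X (X i) :=
  addClosure.of_fintype (σ := Unit) (fun _ => i) (fun _ => 𝟙 _) (fun _ => 𝟙 _) (by simp)

lemma addClosure.of_sum {M : C} {σ : Type*} [Fintype σ] {Y : σ → C}
    (hY : ∀ t, addClosure X (Y t)) (p : ∀ t, M ⟶ Y t) (q : ∀ t, Y t ⟶ M)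
    (h : ∑ t, p t ≫ q t = 𝟙 M) : addClosure X M := by
  choose m i p' q' h' using hY
  refine addClosure.of_fintype (σ := Σ t, Fin (m t)) (fun t => i t.1 t.2)
    (fun t => p t.1 ≫ p' t.1 t.2) (fun t => q' t.1 t.2 ≫ q t.1) ?_
  rw [← h, Fintype.sum_sigma]
  refine Finset.sum_congr rfl fun t _ => ?_
  calc _ = p t ≫ (∑ s, p' t s ≫ q' t s) ≫ q t := by
        simp [Preadditive.sum_comp, Preadditive.comp_sum]
    _ = _ := by rw [h']; simp

lemma addClosure.of_iso {M N : C} (e : M ≅ N) (hN : addClosure X N) : addClosure X M :=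
  addClosure.of_sum (σ := Unit) (fun _ => hN) (fun _ => e.hom) (fun _ => e.inv) (by simp)

end addClosure

/-- The full subcategory on the objects with property `T`, with its morphism sets lifted to the
universe of its objects, so that it becomes a small category in that universe. -/
structure Full {C : Type (u + 1)} [Category.{u} C] (T : ObjectProperty C) : Type (u + 1) where
  obj : C
  property : T obj

section Full

variable {C : Type (u + 1)} [Category.{u} C] {T : ObjectProperty C}

@[ext]
structure Full.Hom (X Y : Full T) : Type (u + 1) where
  hom : X.obj ⟶ Y.obj

instance : Category.{u + 1} (Full T) where
  Hom := Full.Hom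
  id X := ⟨𝟙 X.obj⟩
  comp f g := ⟨f.hom ≫ g.hom⟩

@[ext]
lemma Full.hom_ext {X Y : Full T} {f g : X ⟶ Y} (h : f.hom = g.hom) : f = g :=
  Full.Hom.ext h

@[simp] lemma Full.id_hom (X : Full T) : Full.Hom.hom (𝟙 X) = 𝟙 X.obj := rfl
@[simp] lemma Full.comp_hom {X Y Z : Full T} (f : X ⟶ Y) (g : Y ⟶ Z) :
    Full.Hom.hom (f ≫ g) = f.hom ≫ g.hom := rfl

@[simps]
def Full.isoMk {X Y : Full T} (e : X.obj ≅ Y.obj) : X ≅ Y where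
  hom := ⟨e.hom⟩
  inv := ⟨e.inv⟩

def Full.homEquiv (X Y : Full T) : (X ⟶ Y) ≃ (X.obj ⟶ Y.obj) where
  toFun f := f.hom
  invFun f := ⟨f⟩

variable [Preadditive C]

instance (X Y : Full T) : AddCommGroup (X ⟶ Y) := (Full.homEquiv X Y).addCommGroup

@[simp] lemma Full.add_hom {X Y : Full T} (f g : X ⟶ Y) :
    Full.Hom.hom (f + g) = f.hom + g.hom := rfl

instance : Preadditive (Full T) where

variable [Linear k C]

instance (X Y : Full T) : Module k (X ⟶ Y) := (Full.homEquiv X Y).module k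

@[simp] lemma Full.smul_hom {X Y : Full T} (r : k) (f : X ⟶ Y) :
    Full.Hom.hom (r • f) = r • f.hom := rfl

instance : Linear k (Full T) where

end Full

/-! ### One-object subbicategories and their representations -/

section Deloop

variable {𝔐 : Type (u + 1)} [Bicategory.{u, u + 1} 𝔐]

/-- A class of endomorphisms of `a` that contains the identity and is closed under composition. -/
structure EndClass (a : 𝔐) where
  prop : ObjectProperty (a ⟶ a)
  id : prop (𝟙 a)
  comp : ∀ {M N : a ⟶ a}, prop M → prop N → prop (M ≫ N)

/-- The one-object bicategory whose 1-morphisms are the members of `S` and whose 2-morphisms are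
all 2-morphisms between them. Composition of `F` followed by `G` is `G ≫ F`: in
a bicategory of bimodules, where `≫` is the tensor product, this is the delooping of a
monoidal category of bimodules, with `G ∘ F = G ⊗ F`. -/
structure Deloop {a : 𝔐} (S : EndClass a) : Type where
  star ::

variable {a : 𝔐} {S : EndClass a}

instance Deloop.categoryStruct : CategoryStruct (Deloop S) where
  Hom _ _ := Full S.prop
  id _ := ⟨𝟙 a, S.id⟩
  comp F G := ⟨G.obj ≫ F.obj, S.comp G.property F.property⟩

instance Deloop.homCategory (x y : Deloop S) : Category (x ⟶ y) :=
  inferInstanceAs (Category (Full S.prop))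

section
variable {x y z : Deloop S}
@[simp] lemma Deloop.id_obj : Full.obj (𝟙 x : x ⟶ x) = 𝟙 a := rfl
@[simp] lemma Deloop.comp_obj (F : x ⟶ y) (G : y ⟶ z) :
    Full.obj (F ≫ G) = G.obj ≫ F.obj := rfl
@[simp] lemma Deloop.id_hom (F : x ⟶ y) : Full.Hom.hom (𝟙 F) = 𝟙 F.obj := rfl
@[simp] lemma Deloop.comp_hom {F G H : x ⟶ y} (f : F ⟶ G) (g : G ⟶ H) :
    Full.Hom.hom (f ≫ g) = f.hom ≫ g.hom := rfl
@[ext] lemma Deloop.hom_ext {F G : x ⟶ y} {f g : F ⟶ G} (h : f.hom = g.hom) : f = g :=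
  Full.Hom.ext h
@[simps]
def Deloop.isoMk {F G : x ⟶ y} (e : F.obj ≅ G.obj) : F ≅ G where
  hom := ⟨e.hom⟩
  inv := ⟨e.inv⟩
end

@[simps! whiskerLeft_hom whiskerRight_hom associator_hom_hom associator_inv_hom
  leftUnitor_hom_hom leftUnitor_inv_hom rightUnitor_hom_hom rightUnitor_inv_hom]
instance Deloop.bicategory : Bicategory (Deloop S) where
  homCategory := Deloop.homCategory
  whiskerLeft F G H f := Full.Hom.mk (X := F ≫ G) (Y := F ≫ H) (f.hom ▷ F.obj)
  whiskerRight {_ _ _ F G} f H := Full.Hom.mk (X := F ≫ H) (Y := G ≫ H) (H.obj ◁ f.hom)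
  associator F G H := Deloop.isoMk (F := (F ≫ G) ≫ H) (G := F ≫ G ≫ H)
    (α_ H.obj G.obj F.obj).symm
  leftUnitor {x _} F := Deloop.isoMk (F := 𝟙 x ≫ F) (G := F) (ρ_ F.obj)
  rightUnitor {_ y} F := Deloop.isoMk (F := F ≫ 𝟙 y) (G := F) (λ_ F.obj)
  whisker_exchange f g := by ext; exact (whisker_exchange _ _).symm

variable [PreadditiveBicategory 𝔐] [LinearBicategory k 𝔐]

instance : PreadditiveBicategory (Deloop S) where
  homPreadditive _ _ := inferInstanceAs (Preadditive (Full S.prop))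
  whiskerLeft_add _ _ _ f g := Full.Hom.ext (PreadditiveBicategory.add_whiskerRight f.hom g.hom _)
  add_whiskerRight f g _ := Full.Hom.ext (PreadditiveBicategory.whiskerLeft_add _ f.hom g.hom)

instance : LinearBicategory k (Deloop S) where
  homLinear _ _ := inferInstanceAs (Linear k (Full S.prop))
  whiskerLeft_smul _ _ _ r f := Full.Hom.ext (LinearBicategory.smul_whiskerRight r f.hom _)
  smul_whiskerRight r f _ := Full.Hom.ext (LinearBicategory.whiskerLeft_smul _ r f.hom)

/-- A class of 1-morphisms `a ⟶ z` that is stable under composition with members of `S`. -/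
structure StableClass (S : EndClass a) (z : 𝔐) where
  prop : ObjectProperty (a ⟶ z)
  act : ∀ {M : a ⟶ a} {X : a ⟶ z}, S.prop M → prop X → prop (M ≫ X)

end Deloop

section Rep

variable {𝔐 : Type (u + 1)} [Bicategory.{u, u + 1} 𝔐] [PreadditiveBicategory 𝔐]
  [LinearBicategory k 𝔐] {a z : 𝔐} {S : EndClass a}

/-- The action of `F` in `S` on a stable class: `X ↦ F ≫ X`. -/
@[simps]
def StableClass.actFunctor (T : StableClass S z) (F : Full S.prop) :
    Full T.prop ⥤ Full T.prop where
  obj X := ⟨F.obj ≫ X.obj, T.act F.property X.property⟩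
  map f := ⟨F.obj ◁ f.hom⟩

instance (T : StableClass S z) (F : Full S.prop) : (T.actFunctor F).Additive where
  map_add := Full.Hom.ext (PreadditiveBicategory.whiskerLeft_add _ _ _)

instance (T : StableClass S z) (F : Full S.prop) : (T.actFunctor F).Linear k where
  map_smul _ _ := Full.Hom.ext (LinearBicategory.whiskerLeft_smul _ _ _)

/-- The `k`-linear category of the members of a stable class. -/
abbrev StableClass.cat (k : Type u) [Field k] [LinearBicategory k 𝔐] (T : StableClass S z) :
    LinCat.{u, u + 1} k where
  carrier := Full T.prop

/-- The pseudofunctor given by the action of `S` on a stable class. -/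
def StableClass.pseudo (k : Type u) [Field k] [LinearBicategory k 𝔐] (T : StableClass S z) :
    Deloop S ⥤ᵖ LinCat.{u, u + 1} k where
  obj _ := T.cat k
  map F := LinFunctor.mk (C := T.cat k) (D := T.cat k) (T.actFunctor F)
  map₂ η := LinFunctor.Hom.mk
    { app := fun X => Full.Hom.mk (η.hom ▷ X.obj)
      naturality := fun X Y f => Full.Hom.ext (whisker_exchange η.hom f.hom) }
  mapId _ := LinCat.isoMk (NatIso.ofComponents (fun X => Full.isoMk (λ_ X.obj))
    (fun f => Full.Hom.ext (leftUnitor_naturality f.hom)))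
  mapComp F G := LinCat.isoMk (NatIso.ofComponents
    (fun X => Full.isoMk (α_ G.obj F.obj X.obj))
    (fun f => Full.Hom.ext (associator_naturality_right _ _ f.hom)))
  map₂_id F := LinCat.hom_ext fun X => Full.Hom.ext (id_whiskerRight _ _)
  map₂_comp f g := LinCat.hom_ext fun X => Full.Hom.ext (comp_whiskerRight _ _ _)
  map₂_whisker_left {_ _ _} F G H η := LinCat.hom_ext fun X => Full.Hom.ext <|
    show (η.hom ▷ F.obj) ▷ X.obj = (α_ G.obj F.obj X.obj).hom ≫ η.hom ▷ (F.obj ≫ X.obj) ≫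
      (α_ H.obj F.obj X.obj).inv by simp
  map₂_whisker_right {_ _ _ F G} η H := LinCat.hom_ext fun X => Full.Hom.ext <|
    show (H.obj ◁ η.hom) ▷ X.obj = (α_ H.obj F.obj X.obj).hom ≫ H.obj ◁ η.hom ▷ X.obj ≫
      (α_ H.obj G.obj X.obj).inv by simp
  map₂_associator F G H := LinCat.hom_ext fun X => Full.Hom.ext <|
    show (α_ H.obj G.obj F.obj).inv ▷ X.obj = (α_ H.obj (G.obj ≫ F.obj) X.obj).hom ≫
      H.obj ◁ (α_ G.obj F.obj X.obj).hom ≫ 𝟙 _ ≫ (α_ H.obj G.obj (F.obj ≫ X.obj)).inv ≫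
      (α_ (H.obj ≫ G.obj) F.obj X.obj).inv by simp
  map₂_left_unitor F := LinCat.hom_ext fun X => Full.Hom.ext <|
    show (ρ_ F.obj).hom ▷ X.obj = (α_ F.obj (𝟙 a) X.obj).hom ≫ F.obj ◁ (λ_ X.obj).hom ≫ 𝟙 _ by
      simp
  map₂_right_unitor F := LinCat.hom_ext fun X => Full.Hom.ext <|
    show (λ_ F.obj).hom ▷ X.obj = (α_ (𝟙 a) F.obj X.obj).hom ≫ (λ_ (F.obj ≫ X.obj)).hom ≫ 𝟙 _ by
      simp

/-- The birepresentation given by the action of `S` on a stable class. -/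
def StableClass.rep (k : Type u) [Field k] [LinearBicategory k 𝔐] (T : StableClass S z) :
    LinRep.{u, u + 1} k (Deloop S) where
  toPseudofunctor := T.pseudo k
  map₂_add η θ := LinCat.hom_ext fun X => Full.Hom.ext
    (PreadditiveBicategory.add_whiskerRight η.hom θ.hom X.obj)
  map₂_smul r η := LinCat.hom_ext fun X => Full.Hom.ext
    (LinearBicategory.smul_whiskerRight r η.hom X.obj)

/-- The stable class `S` itself: its birepresentation is the principal one. -/
@[simps]
def EndClass.stable (S : EndClass a) : StableClass S a where
  prop := S.prop
  act := S.comp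

/-- The inclusion of a stable class in a larger one, as a strong transformation. -/
def StableClass.incl (k : Type u) [Field k] [LinearBicategory k 𝔐] {T T' : StableClass S z}
    (h : T.prop ≤ T'.prop) : T.rep k ⟶ T'.rep k :=
  InducedBicategory.mkHom (F := LinPseudofunctor.toPseudofunctor) (X := T.rep k) (Y := T'.rep k)
  { app := fun _ => LinFunctor.mk (C := T.cat k) (D := T'.cat k)
      { obj := fun X => ⟨X.obj, h _ X.property⟩
        map := fun f => ⟨f.hom⟩ }
      (additive := { map_add := rfl }) (linear := { map_smul := fun _ _ => rfl })
    naturality := fun F => LinCat.isoMk (NatIso.ofComponents (fun X => Full.isoMk (Iso.refl _))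
      (fun {X Y} f => Full.Hom.ext <|
        show F.obj ◁ f.hom ≫ 𝟙 (F.obj ≫ Y.obj) = 𝟙 (F.obj ≫ X.obj) ≫ F.obj ◁ f.hom by simp))
    naturality_naturality := fun {_ _ F G} η => LinCat.hom_ext fun X => Full.Hom.ext <|
      show η.hom ▷ X.obj ≫ 𝟙 (G.obj ≫ X.obj) = 𝟙 (F.obj ≫ X.obj) ≫ η.hom ▷ X.obj by simp
    naturality_id := fun _ => LinCat.hom_ext fun X => Full.Hom.ext <|
      show 𝟙 (𝟙 a ≫ X.obj) ≫ (λ_ X.obj).hom = (λ_ X.obj).hom ≫ 𝟙 X.obj ≫ 𝟙 X.obj by simp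
    naturality_comp := fun F G => LinCat.hom_ext fun X => Full.Hom.ext <|
      show 𝟙 ((G.obj ≫ F.obj) ≫ X.obj) ≫ (α_ G.obj F.obj X.obj).hom =
        (α_ G.obj F.obj X.obj).hom ≫ 𝟙 _ ≫ 𝟙 (G.obj ≫ F.obj ≫ X.obj) ≫ 𝟙 _ ≫
          G.obj ◁ 𝟙 (F.obj ≫ X.obj) ≫ 𝟙 _ by simp }

/-- Composition with a fixed 1-morphism `X`, from the principal birepresentation to a stable class
that contains `X`: the strong transformation `F ↦ F ≫ X`. -/
def StableClass.yoneda (k : Type u) [Field k] [LinearBicategory k 𝔐] (T : StableClass S z)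
    (X : Full T.prop) : S.stable.rep k ⟶ T.rep k :=
  InducedBicategory.mkHom (F := LinPseudofunctor.toPseudofunctor) (X := S.stable.rep k)
    (Y := T.rep k)
  { app := fun _ => LinFunctor.mk (C := S.stable.cat k) (D := T.cat k)
      { obj := fun M => ⟨M.obj ≫ X.obj, T.act M.property X.property⟩
        map := fun f => ⟨f.hom ▷ X.obj⟩ }
      (additive := { map_add := Full.Hom.ext (PreadditiveBicategory.add_whiskerRight _ _ _) })
      (linear := { map_smul := fun _ _ => Full.Hom.ext (LinearBicategory.smul_whiskerRight _ _ _) })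
    naturality := fun F => LinCat.isoMk (NatIso.ofComponents
      (fun M => Full.isoMk (α_ F.obj M.obj X.obj))
      (fun f => Full.Hom.ext (associator_naturality_middle F.obj f.hom X.obj)))
    naturality_naturality := fun η => LinCat.hom_ext fun M => Full.Hom.ext
      (associator_naturality_left η.hom M.obj X.obj)
    naturality_id := fun _ => LinCat.hom_ext fun M => Full.Hom.ext <|
      show (α_ (𝟙 a) M.obj X.obj).hom ≫ (λ_ (M.obj ≫ X.obj)).hom =
        (λ_ M.obj).hom ▷ X.obj ≫ 𝟙 _ ≫ 𝟙 _ by simp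
    naturality_comp := fun F G => LinCat.hom_ext fun M => Full.Hom.ext <|
      show (α_ (G.obj ≫ F.obj) M.obj X.obj).hom ≫ (α_ G.obj F.obj (M.obj ≫ X.obj)).hom =
        (α_ G.obj F.obj M.obj).hom ▷ X.obj ≫ 𝟙 _ ≫ (α_ G.obj (F.obj ≫ M.obj) X.obj).hom ≫ 𝟙 _ ≫
          G.obj ◁ (α_ F.obj M.obj X.obj).hom ≫ 𝟙 _ by simp }

end Rep

section Transport

variable {𝔐 : Type (u + 1)} [Bicategory.{u, u + 1} 𝔐] {a z : 𝔐} {ι : Type*} {X : ι → (a ⟶ z)}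
  {E : a ⟶ z}

/-- `M` transports the 1-morphisms `X i` along `ρ i : X i ⟶ E` if the 2-morphisms
`M ◁ ρ i` are monomorphisms with the same image. -/
structure Transports (ρ : ∀ i, X i ⟶ E) {x : 𝔐} (M : x ⟶ a) : Prop where
  mono : ∀ i, Mono (M ◁ ρ i)
  exists_lift : ∀ i j, ∃ s : M ≫ X i ⟶ M ≫ X j, s ≫ M ◁ ρ j = M ◁ ρ i

namespace Transports

variable {ρ : ∀ i, X i ⟶ E} {x : 𝔐} {M : x ⟶ a}

/-- The unique `s : M ≫ X i ⟶ M ≫ X j` with `s ≫ M ◁ ρ j = M ◁ ρ i`. -/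
noncomputable def lift (h : Transports ρ M) (i j : ι) : M ≫ X i ⟶ M ≫ X j :=
  (h.exists_lift i j).choose

@[simp]
lemma lift_comp (h : Transports ρ M) (i j : ι) : h.lift i j ≫ M ◁ ρ j = M ◁ ρ i :=
  (h.exists_lift i j).choose_spec

lemma lift_comp_assoc (h : Transports ρ M) (i j : ι) {Z : x ⟶ z} (f : M ≫ E ⟶ Z) :
    h.lift i j ≫ M ◁ ρ j ≫ f = M ◁ ρ i ≫ f := by
  rw [← Category.assoc, lift_comp]

lemma of_retraction (r : ∀ j, M ≫ E ⟶ M ≫ X j) (h₁ : ∀ j, M ◁ ρ j ≫ r j = 𝟙 _)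
    (h₂ : ∀ i j, M ◁ ρ i ≫ r j ≫ M ◁ ρ j = M ◁ ρ i) : Transports ρ M where
  mono i := (SplitMono.mk (r i) (h₁ i)).mono
  exists_lift i j := ⟨M ◁ ρ i ≫ r j, by rw [Category.assoc, h₂]⟩

lemma comp_of_retraction (r : ∀ j, M ≫ E ⟶ M ≫ X j) (h₁ : ∀ j, M ◁ ρ j ≫ r j = 𝟙 _)
    (h₂ : ∀ i j, M ◁ ρ i ≫ r j ≫ M ◁ ρ j = M ◁ ρ i) {y : 𝔐} (L : y ⟶ x) :
    Transports ρ (L ≫ M) := by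
  refine of_retraction (fun j => (α_ _ _ _).hom ≫ L ◁ r j ≫ (α_ _ _ _).inv) (fun j => ?_)
    fun i j => ?_
  · have := congrArg (fun t => (α_ L M (X j)).hom ≫ L ◁ t ≫ (α_ L M (X j)).inv) (h₁ j)
    simpa using this
  · have := congrArg (fun t => (α_ L M (X i)).hom ≫ L ◁ t ≫ (α_ L M E).inv) (h₂ i j)
    simpa using this

lemma of_addClosure [PreadditiveBicategory 𝔐] {σ : Type*} {Y : σ → (x ⟶ a)}
    (hY : ∀ t, Transports ρ (Y t)) (hM : addClosure Y M) : Transports ρ M := by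
  obtain ⟨m, l, p, q, h⟩ := hM
  have hadd : ∀ (Z : a ⟶ z), ∑ t, p t ▷ Z ≫ q t ▷ Z = 𝟙 (M ≫ Z) := fun Z => by
    let W : (M ⟶ M) →+ (M ≫ Z ⟶ M ≫ Z) :=
      AddMonoidHom.mk' (fun f => f ▷ Z) (fun f g => PreadditiveBicategory.add_whiskerRight f g Z)
    have := congrArg W h
    rw [map_sum] at this
    simpa [W] using this
  refine ⟨fun i => ⟨fun {T} f g hfg => ?_⟩, fun i j => ⟨∑ t, p t ▷ X i ≫ (hY (l t)).lift i j ≫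
    q t ▷ X j, ?_⟩⟩
  · have key : ∀ t, f ≫ p t ▷ X i = g ≫ p t ▷ X i := fun t => by
      have := (hY (l t)).mono i
      rw [← cancel_mono (Y (l t) ◁ ρ i), Category.assoc, Category.assoc, ← whisker_exchange,
        ← Category.assoc, hfg, Category.assoc]
    rw [← Category.comp_id f, ← Category.comp_id g, ← hadd, Preadditive.comp_sum,
      Preadditive.comp_sum]
    refine Finset.sum_congr rfl fun t _ => ?_
    rw [← Category.assoc, key, Category.assoc]
  · rw [Preadditive.sum_comp]
    calc _ = ∑ t, (p t ▷ X i ≫ q t ▷ X i) ≫ M ◁ ρ i := by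
          refine Finset.sum_congr rfl fun t _ => ?_
          rw [Category.assoc, Category.assoc, Category.assoc, ← whisker_exchange, lift_comp_assoc,
            ← whisker_exchange]
      _ = _ := by rw [← Preadditive.sum_comp, hadd, Category.id_comp]

end Transports

variable [PreadditiveBicategory 𝔐] [LinearBicategory k 𝔐] {S : EndClass a}

/-- Let the members of the stable class `N` transport the members `X i` of the stable class `T`
along `ρ i : X i ⟶ E`. The modification between the restrictions to `N` of the
strong transformations `F ↦ F ≫ X i` and `F ↦ F ≫ X j`, whose component at `M` is the
unique `s : M ≫ X i ⟶ M ≫ X j` with `s ≫ M ◁ ρ j = M ◁ ρ i`. -/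
noncomputable def StableClass.transport (k : Type u) [Field k] [LinearBicategory k 𝔐]
    {N : StableClass S a} (hN : N.prop ≤ S.stable.prop) {T : StableClass S z} {X : ι → Full T.prop}
    {ρ : ∀ i, (X i).obj ⟶ E} (h : ∀ M, N.prop M → Transports ρ M) (i j : ι) :
    incl k hN ≫ T.yoneda k (X i) ⟶ incl k hN ≫ T.yoneda k (X j) :=
  ⟨⟨{ app := fun _ => LinFunctor.Hom.mk
        { app := fun M => Full.Hom.mk ((h M.obj M.property).lift i j)
          naturality := fun M M' f => Full.Hom.ext <| by
            have := (h M'.obj M'.property).mono j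
            change f.hom ▷ (X i).obj ≫ (h M'.obj M'.property).lift i j =
              (h M.obj M.property).lift i j ≫ f.hom ▷ (X j).obj
            rw [← cancel_mono (M'.obj ◁ ρ j), Category.assoc, Category.assoc,
              Transports.lift_comp, ← whisker_exchange, ← whisker_exchange,
              Transports.lift_comp_assoc] }
      naturality := fun F => LinCat.hom_ext fun M => Full.Hom.ext <| by
        have hFM := N.act F.property M.property
        have := (h _ hFM).mono j
        change (h (F.obj ≫ M.obj) hFM).lift i j ≫ 𝟙 _ ≫ 𝟙 (F.obj ≫ M.obj) ▷ (X j).obj ≫ 𝟙 _ ≫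
            (α_ F.obj M.obj (X j).obj).hom ≫ 𝟙 _ =
          (𝟙 _ ≫ 𝟙 (F.obj ≫ M.obj) ▷ (X i).obj ≫ 𝟙 _ ≫ (α_ F.obj M.obj (X i).obj).hom ≫ 𝟙 _) ≫
            F.obj ◁ (h M.obj M.property).lift i j
        simp only [Category.id_comp, id_whiskerRight, Category.comp_id]
        rw [← cancel_mono (α_ F.obj M.obj (X j).obj).inv, ← cancel_mono ((F.obj ≫ M.obj) ◁ ρ j)]
        simp only [Category.assoc, Iso.hom_inv_id, Category.comp_id, Transports.lift_comp]
        rw [← associator_inv_naturality_right, ← whiskerLeft_comp_assoc, Transports.lift_comp,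
          associator_inv_naturality_right, Iso.hom_inv_id_assoc] }⟩⟩

end Transport

/-! ### The linear bicategory of algebras and bimodules -/

/-- The bicategory of `k`-algebras (monoids in the monoidal category of vector spaces), bimodules
and bimodule homomorphisms; composition of 1-morphisms is the tensor product of bimodules. -/
def AlgBim (k : Type u) [Field k] : Type (u + 1) := Mon (ModuleCat.{u} k)

noncomputable instance : Bicategory.{u, u + 1} (AlgBim k) :=
  Bimod.monBicategory (C := ModuleCat.{u} k)

section BimodLinear

open MonoidalCategory

variable {A B : Mon (ModuleCat.{u} k)} {M N : Bimod A B}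

instance : Zero (M ⟶ N) := ⟨⟨0, by simp, by simp⟩⟩
instance : Add (M ⟶ N) := ⟨fun f g => ⟨f.hom + g.hom, by
  rw [Preadditive.comp_add, MonoidalPreadditive.whiskerLeft_add, Preadditive.add_comp,
    f.left_act_hom, g.left_act_hom], by
  rw [Preadditive.comp_add, MonoidalPreadditive.add_whiskerRight, Preadditive.add_comp,
    f.right_act_hom, g.right_act_hom]⟩⟩
instance : SMul k (M ⟶ N) := ⟨fun r f => ⟨r • f.hom, by
  rw [Linear.comp_smul, MonoidalLinear.whiskerLeft_smul, Linear.smul_comp, f.left_act_hom], by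
  rw [Linear.comp_smul, MonoidalLinear.smul_whiskerRight, Linear.smul_comp, f.right_act_hom]⟩⟩
instance : Neg (M ⟶ N) := ⟨fun f => (-1 : k) • f⟩
instance : Sub (M ⟶ N) := ⟨fun f g => f + -g⟩
instance : SMul ℕ (M ⟶ N) := ⟨fun m f => (m : k) • f⟩
instance : SMul ℤ (M ⟶ N) := ⟨fun m f => (m : k) • f⟩

lemma bimod_hom_injective : Function.Injective (fun f : M ⟶ N => f.hom) :=
  fun f g h => Bimod.hom_ext f g h

instance : AddCommGroup (M ⟶ N) :=
  bimod_hom_injective.addCommGroup _ rfl (fun _ _ => rfl)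
    (fun f => show (-1 : k) • f.hom = -f.hom by simp)
    (fun f g => show f.hom + (-1 : k) • g.hom = f.hom - g.hom by simp [sub_eq_add_neg])
    (fun f m => show (m : k) • f.hom = m • f.hom by rw [Nat.cast_smul_eq_nsmul])
    (fun f m => show (m : k) • f.hom = m • f.hom by rw [Int.cast_smul_eq_zsmul])

@[simp] lemma bimod_add_hom (f g : M ⟶ N) : Bimod.Hom.hom (f + g) = f.hom + g.hom := rfl
@[simp] lemma bimod_smul_hom (r : k) (f : M ⟶ N) : Bimod.Hom.hom (r • f) = r • f.hom := rfl

/-- The underlying linear map of a bimodule homomorphism. -/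
def bimodHomAddHom : (M ⟶ N) →+ (M.X ⟶ N.X) where
  toFun f := f.hom
  map_zero' := rfl
  map_add' _ _ := rfl

instance : Module k (M ⟶ N) :=
  bimod_hom_injective.module k bimodHomAddHom (fun _ _ => rfl)

instance instPreadditiveBimod : Preadditive (Bimod A B) where
  add_comp _ _ _ _ _ _ := Bimod.hom_ext _ _ (Preadditive.add_comp _ _ _ _ _ _)
  comp_add _ _ _ _ _ _ := Bimod.hom_ext _ _ (Preadditive.comp_add _ _ _ _ _ _)

instance instLinearBimod : Linear k (Bimod A B) where
  smul_comp _ _ _ _ _ _ := Bimod.hom_ext _ _ (Linear.smul_comp _ _ _ _ _ _)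
  comp_smul _ _ _ _ _ _ := Bimod.hom_ext _ _ (Linear.comp_smul _ _ _ _ _ _)

section
variable {D : Mon (ModuleCat.{u} k)}

/-- The canonical map onto the tensor product of bimodules. -/
noncomputable def bimodπ (M : Bimod A B) (N : Bimod B D) : M.X ⊗ N.X ⟶ (M.tensorBimod N).X :=
  Limits.coequalizer.π _ _

lemma bimodπ_hom_ext {M : Bimod A B} {N : Bimod B D} {Z : ModuleCat.{u} k}
    {f g : (M.tensorBimod N).X ⟶ Z} (h : bimodπ M N ≫ f = bimodπ M N ≫ g) : f = g :=
  Limits.coequalizer.hom_ext h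

lemma bimodπ_whiskerLeft (M : Bimod A B) {N N' : Bimod B D} (f : N ⟶ N') :
    bimodπ M N ≫ (Bimod.whiskerLeft M f).hom = M.X ◁ f.hom ≫ bimodπ M N' := by
  dsimp only [bimodπ, Bimod.whiskerLeft]
  exact Limits.ι_colimMap _ Limits.WalkingParallelPair.one

lemma bimodπ_whiskerRight {M M' : Bimod A B} (f : M ⟶ M') (N : Bimod B D) :
    bimodπ M N ≫ (Bimod.whiskerRight f N).hom = f.hom ▷ N.X ≫ bimodπ M' N := by
  dsimp only [bimodπ, Bimod.whiskerRight]
  exact Limits.ι_colimMap _ Limits.WalkingParallelPair.one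

lemma bimod_whiskerLeft_add (M : Bimod A B) {N N' : Bimod B D} (f g : N ⟶ N') :
    Bimod.whiskerLeft M (f + g) = Bimod.whiskerLeft M f + Bimod.whiskerLeft M g :=
  Bimod.hom_ext _ _ <| bimodπ_hom_ext <| by
    rw [bimod_add_hom, Preadditive.comp_add, bimodπ_whiskerLeft, bimodπ_whiskerLeft,
      bimodπ_whiskerLeft, bimod_add_hom, MonoidalPreadditive.whiskerLeft_add, Preadditive.add_comp]

lemma bimod_add_whiskerRight {M M' : Bimod A B} (f g : M ⟶ M') (N : Bimod B D) :
    Bimod.whiskerRight (f + g) N = Bimod.whiskerRight f N + Bimod.whiskerRight g N :=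
  Bimod.hom_ext _ _ <| bimodπ_hom_ext <| by
    rw [bimod_add_hom, Preadditive.comp_add, bimodπ_whiskerRight, bimodπ_whiskerRight,
      bimodπ_whiskerRight, bimod_add_hom, MonoidalPreadditive.add_whiskerRight,
      Preadditive.add_comp]

lemma bimod_whiskerLeft_smul (M : Bimod A B) {N N' : Bimod B D} (r : k) (f : N ⟶ N') :
    Bimod.whiskerLeft M (r • f) = r • Bimod.whiskerLeft M f :=
  Bimod.hom_ext _ _ <| bimodπ_hom_ext <| by
    rw [bimod_smul_hom, Linear.comp_smul, bimodπ_whiskerLeft, bimodπ_whiskerLeft,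
      bimod_smul_hom, MonoidalLinear.whiskerLeft_smul, Linear.smul_comp]

lemma bimod_smul_whiskerRight {M M' : Bimod A B} (r : k) (f : M ⟶ M') (N : Bimod B D) :
    Bimod.whiskerRight (r • f) N = r • Bimod.whiskerRight f N :=
  Bimod.hom_ext _ _ <| bimodπ_hom_ext <| by
    rw [bimod_smul_hom, Linear.comp_smul, bimodπ_whiskerRight, bimodπ_whiskerRight,
      bimod_smul_hom, MonoidalLinear.smul_whiskerRight, Linear.smul_comp]

end

end BimodLinear

noncomputable instance : PreadditiveBicategory (AlgBim k) where
  homPreadditive A B := instPreadditiveBimod (A := A) (B := B)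
  whiskerLeft_add := bimod_whiskerLeft_add
  add_whiskerRight := bimod_add_whiskerRight

noncomputable instance : LinearBicategory k (AlgBim k) where
  homLinear A B := instLinearBimod (A := A) (B := B)
  whiskerLeft_smul := bimod_whiskerLeft_smul
  smul_whiskerRight := bimod_smul_whiskerRight

section Algebras

open MonoidalCategory ModuleCat
open scoped TensorProduct

/-- A `k`-algebra as an object of the bicategory of algebras and bimodules. -/
noncomputable def algMon (k : Type u) [Field k] (R : Type u) [Ring R] [Algebra k R] : Mon (ModuleCat.{u} k) :=
  @Mon.mk _ _ _ (ModuleCat.of k R)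
    (ModuleCat.MonModuleEquivalenceAlgebra.inverseObj (AlgCat.of k R))

variable {R R' : Type u} [Ring R] [Algebra k R] [Ring R'] [Algebra k R']
  {V V' : Type u} [AddCommGroup V] [Module k V] [AddCommGroup V'] [Module k V']

/-- The `R`-`R'`-bimodule with underlying vector space `V`, left action `l` and right action `r`. -/
noncomputable def mkBimod (l : R →ₗ[k] V →ₗ[k] V) (r : V →ₗ[k] R' →ₗ[k] V)
    (one_l : ∀ v, l 1 v = v) (mul_l : ∀ s t v, l (s * t) v = l s (l t v))
    (one_r : ∀ v, r v 1 = v) (mul_r : ∀ v s t, r v (s * t) = r (r v s) t)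
    (mid : ∀ s v t, r (l s v) t = l s (r v t)) : Bimod (algMon k R) (algMon k R') where
  X := ModuleCat.of k V
  actLeft := ofHom (TensorProduct.lift l)
  actRight := ofHom (TensorProduct.lift r)
  one_actLeft := by
    refine MonoidalCategory.tensor_ext fun c v => ?_
    change l (algebraMap k R c) v = c • v
    rw [Algebra.algebraMap_eq_smul_one, map_smul, LinearMap.smul_apply, one_l]
  left_assoc := MonoidalCategory.tensor_ext₃' mul_l
  actRight_one := by
    refine MonoidalCategory.tensor_ext fun v c => ?_
    change r v (algebraMap k R' c) = c • v
    rw [Algebra.algebraMap_eq_smul_one, map_smul, one_r]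
  right_assoc := MonoidalCategory.tensor_ext₃ mul_r
  middle_assoc := MonoidalCategory.tensor_ext₃' mid

/-- The left ideal `R e`, as a vector space. -/
def leftIdeal (k : Type u) [Field k] [Algebra k R] (e : R) : Submodule k R where
  carrier := {x | x * e = x}
  zero_mem' := zero_mul e
  add_mem' hx hy := by rw [Set.mem_ofPred_eq, add_mul, hx, hy]
  smul_mem' c x hx := by rw [Set.mem_ofPred_eq, smul_mul_assoc, hx]

/-- The right ideal `e R`, as a vector space. -/
def rightIdeal (k : Type u) [Field k] [Algebra k R] (e : R) : Submodule k R where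
  carrier := {x | e * x = x}
  zero_mem' := mul_zero e
  add_mem' hx hy := by rw [Set.mem_ofPred_eq, mul_add, hx, hy]
  smul_mem' c x hx := by rw [Set.mem_ofPred_eq, mul_smul_comm, hx]

/-- The left module `R e`, for an idempotent `e`, as an `R`-`k`-bimodule. -/
noncomputable def leftBimod (k : Type u) [Field k] [Algebra k R] (e : R) :
    Bimod (algMon k R) (algMon k k) :=
  mkBimod (V := leftIdeal k e)
    (LinearMap.mk₂ k (fun s v => ⟨s * v.1, by
        have : v.1 * e = v.1 := v.2
        change s * v.1 * e = s * v.1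
        rw [mul_assoc, this]⟩)
      (fun _ _ _ => Subtype.ext (add_mul _ _ _)) (fun _ _ _ => Subtype.ext (smul_mul_assoc _ _ _))
      (fun _ _ _ => Subtype.ext (mul_add _ _ _)) (fun _ _ _ => Subtype.ext (mul_smul_comm _ _ _)))
    (LinearMap.lsmul k _).flip
    (fun v => Subtype.ext (one_mul _)) (fun s t v => Subtype.ext (mul_assoc _ _ _))
    (fun v => one_smul k v) (fun v s t => by
      change (s * t) • v = t • s • v
      rw [mul_comm, mul_smul])
    (fun s v t => Subtype.ext (mul_smul_comm t s v.1).symm)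

/-- The right module `e R`, for an idempotent `e`, as a `k`-`R`-bimodule. -/
noncomputable def rightBimod (k : Type u) [Field k] [Algebra k R] (e : R) :
    Bimod (algMon k k) (algMon k R) :=
  mkBimod (V := rightIdeal k e) (LinearMap.lsmul k _)
    (LinearMap.mk₂ k (fun v s => ⟨v.1 * s, by
        have : e * v.1 = v.1 := v.2
        change e * (v.1 * s) = v.1 * s
        rw [← mul_assoc, this]⟩)
      (fun _ _ _ => Subtype.ext (add_mul _ _ _)) (fun _ _ _ => Subtype.ext (smul_mul_assoc _ _ _))
      (fun _ _ _ => Subtype.ext (mul_add _ _ _)) (fun _ _ _ => Subtype.ext (mul_smul_comm _ _ _)))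
    (fun v => one_smul k v) (fun s t v => mul_smul s t v)
    (fun v => Subtype.ext (mul_one _)) (fun v s t => Subtype.ext (mul_assoc _ _ _).symm)
    (fun s v t => Subtype.ext (smul_mul_assoc s v.1 t))

/-- Right multiplication by `t`, from `R e` to `R e'`, where `t e' = t`. -/
noncomputable def rightMul {e e' : R} (t : R) (ht : t * e' = t) :
    leftBimod k e ⟶ leftBimod k e' where
  hom := ofHom (X := leftIdeal k e) (Y := leftIdeal k e')
    { toFun := fun v => ⟨v.1 * t, by
        change v.1 * t * e' = v.1 * t
        rw [mul_assoc, ht]⟩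
      map_add' := fun _ _ => Subtype.ext (add_mul _ _ _)
      map_smul' := fun _ _ => Subtype.ext (smul_mul_assoc _ _ _) }
  left_act_hom := MonoidalCategory.tensor_ext fun (s : R) (v : leftIdeal k e) =>
    Subtype.ext (mul_assoc s v.1 t)
  right_act_hom := MonoidalCategory.tensor_ext fun (v : leftIdeal k e) (s : k) =>
    Subtype.ext (smul_mul_assoc s v.1 t)

/-- Every linear map between `k`-`k`-bimodules is a bimodule homomorphism. -/
def mkScalarHom {M N : Bimod (algMon k k) (algMon k k)} (f : M.X ⟶ N.X) : M ⟶ N where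
  hom := f
  left_act_hom := by
    have hl : ∀ (M : Bimod (algMon k k) (algMon k k)) (s : k) (v : M.X),
        M.actLeft (s ⊗ₜ[k] v) = s • v := fun M s v => by
      have h := ConcreteCategory.congr_hom M.one_actLeft (s ⊗ₜ[k] v)
      exact h
    refine MonoidalCategory.tensor_ext fun (s : k) v => ?_
    change f (M.actLeft (s ⊗ₜ[k] v)) = N.actLeft (s ⊗ₜ[k] f v)
    exact ((congrArg f (hl M s v)).trans (map_smul f.hom (s : k) v)).trans (hl N s (f v)).symm
  right_act_hom := by
    have hr : ∀ (M : Bimod (algMon k k) (algMon k k)) (v : M.X) (s : k),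
        M.actRight (v ⊗ₜ[k] s) = s • v := fun M v s => by
      have h := ConcreteCategory.congr_hom M.actRight_one (v ⊗ₜ[k] s)
      exact h
    refine MonoidalCategory.tensor_ext fun v (s : k) => ?_
    change f (M.actRight (v ⊗ₜ[k] s)) = N.actRight (f v ⊗ₜ[k] s)
    exact ((congrArg f (hr M v s)).trans (map_smul f.hom (s : k) v)).trans (hr N (f v) s).symm

lemma addClosure_regular (M : Bimod (algMon k k) (algMon k k)) [Module.Finite k M.X] :
    addClosure (fun _ : Unit => Bimod.regular (algMon k k)) M := by
  let b := Module.finBasis k M.X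
  refine addClosure.of_fintype (σ := Fin _) (fun _ => ())
    (fun t => mkScalarHom (ofHom (Y := k) (b.coord t)))
    (fun t => mkScalarHom (ofHom (X := k) (LinearMap.toSpanSingleton k M.X (b t)))) ?_
  refine Bimod.hom_ext _ _ (ModuleCat.hom_ext (LinearMap.ext fun v => ?_))
  have h : ∀ {σ : Type} (s : Finset σ) (f : σ → (M ⟶ M)), (∑ t ∈ s, f t).hom.hom v =
      ∑ t ∈ s, (f t).hom.hom v := fun s f => by
    classical
    induction s using Finset.induction_on with
    | empty => rfl
    | insert t s hs ih => rw [Finset.sum_insert hs, Finset.sum_insert hs, ← ih]; rfl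
  rw [h]
  exact b.sum_repr v

lemma bimodπ_surjective {A B D : Mon (ModuleCat.{u} k)} (M : Bimod A B) (N : Bimod B D) :
    Function.Surjective (bimodπ M N) :=
  (ModuleCat.epi_iff_surjective _).1 (inferInstanceAs (Epi (Limits.coequalizer.π _ _)))

lemma bimod_tensor_finite {A B D : Mon (ModuleCat.{u} k)} (M : Bimod A B) (N : Bimod B D)
    [Module.Finite k M.X] [Module.Finite k N.X] : Module.Finite k (M.tensorBimod N).X :=
  have : Module.Finite k (M.X ⊗ N.X : ModuleCat k) :=
    inferInstanceAs (Module.Finite k (M.X ⊗[k] N.X))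
  Module.Finite.of_surjective (bimodπ M N).hom (bimodπ_surjective M N)

/-- The elements `x ⊗ y` of the tensor product `e R ⊗ R e'`. -/
noncomputable def idealTmul {e e' : R} (x : rightIdeal k e) (y : leftIdeal k e') :
    ((rightBimod k e).tensorBimod (leftBimod k e')).X :=
  bimodπ (rightBimod k e) (leftBimod k e')
    ((x : (rightBimod k e).X) ⊗ₜ[k] (y : (leftBimod k e').X))

/-- The product `s y` of `s` in `R` and `y` in `R e`. -/
def lmulIdeal {e : R} (s : R) (y : leftIdeal k e) : leftIdeal k e :=
  ⟨s * y.1, by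
    have : y.1 * e = y.1 := y.2
    change s * y.1 * e = s * y.1
    rw [mul_assoc, this]⟩

/-- The product `x s` of `x` in `e R` and `s` in `R`. -/
def rmulIdeal {e : R} (x : rightIdeal k e) (s : R) : rightIdeal k e :=
  ⟨x.1 * s, by
    have : e * x.1 = x.1 := x.2
    change e * (x.1 * s) = x.1 * s
    rw [← mul_assoc, this]⟩

lemma bimodπ_balanced {A B D : Mon (ModuleCat.{u} k)} (M : Bimod A B) (N : Bimod B D)
    (x : M.X) (s : B.X) (y : N.X) :
    bimodπ M N (M.actRight (x ⊗ₜ[k] s) ⊗ₜ[k] y) = bimodπ M N (x ⊗ₜ[k] N.actLeft (s ⊗ₜ[k] y)) := by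
  have h : M.actRight ▷ N.X ≫ bimodπ M N =
      ((α_ M.X B.X N.X).hom ≫ M.X ◁ N.actLeft) ≫ bimodπ M N :=
    Limits.coequalizer.condition _ _
  have h' := ConcreteCategory.congr_hom h ((x ⊗ₜ[k] s) ⊗ₜ[k] y)
  rw [ConcreteCategory.comp_apply, ConcreteCategory.comp_apply, ConcreteCategory.comp_apply] at h'
  exact h'

/-- The linear map on a tensor product of bimodules induced by a balanced bilinear map. -/
noncomputable def bimodDesc {A B D : Mon (ModuleCat.{u} k)} {M : Bimod A B} {N : Bimod B D}
    {Z : ModuleCat.{u} k} (f : M.X ⊗ N.X ⟶ Z)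
    (h : ∀ (x : M.X) (s : B.X) (y : N.X),
      f (M.actRight (x ⊗ₜ[k] s) ⊗ₜ[k] y) = f (x ⊗ₜ[k] N.actLeft (s ⊗ₜ[k] y))) :
    (M.tensorBimod N).X ⟶ Z :=
  Limits.coequalizer.desc f (MonoidalCategory.tensor_ext₃' h)

lemma bimodπ_desc {A B D : Mon (ModuleCat.{u} k)} {M : Bimod A B} {N : Bimod B D}
    {Z : ModuleCat.{u} k} (f : M.X ⊗ N.X ⟶ Z)
    (h : ∀ (x : M.X) (s : B.X) (y : N.X),
      f (M.actRight (x ⊗ₜ[k] s) ⊗ₜ[k] y) = f (x ⊗ₜ[k] N.actLeft (s ⊗ₜ[k] y))) :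
    bimodπ M N ≫ bimodDesc f h = f :=
  Limits.coequalizer.π_desc _ _

lemma idealTmul_balanced {e e' : R} (x : rightIdeal k e) (s : R) (y : leftIdeal k e') :
    idealTmul (rmulIdeal x s) y = idealTmul x (lmulIdeal s y) :=
  bimodπ_balanced (rightBimod k e) (leftBimod k e') x s y

lemma idealTmul_smul {e e' : R} (c : k) (x : rightIdeal k e) (y : leftIdeal k e') :
    idealTmul (c • x) y = c • idealTmul x y :=
  (congrArg (bimodπ (rightBimod k e) (leftBimod k e')).hom
    (TensorProduct.smul_tmul' (R := k) (R' := k) c (x : (rightBimod k e).X)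
      (y : (leftBimod k e').X)).symm).trans (map_smul (bimodπ _ _).hom c _)

lemma idealTmul_hom_ext {e e' : R} {Z : ModuleCat.{u} k}
    {f g : ((rightBimod k e).tensorBimod (leftBimod k e')).X ⟶ Z}
    (h : ∀ x y, f (idealTmul x y) = g (idealTmul x y)) : f = g :=
  bimodπ_hom_ext (MonoidalCategory.tensor_ext h)

/-- The bilinear map `(x, y) ↦ ψ (x y)`. -/
noncomputable def idealPairing {e e' : R} {Z : ModuleCat.{u} k} (ψ : R →ₗ[k] Z) :
    (rightBimod k e).X ⊗ (leftBimod k e').X ⟶ Z :=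
  ofHom (TensorProduct.lift (M := rightIdeal k e) (N := leftIdeal k e')
    (((LinearMap.mul k R).domRestrict₁₂ (rightIdeal k e) (leftIdeal k e')).compr₂ ψ))

lemma idealPairing_tmul {e e' : R} {Z : ModuleCat.{u} k} (ψ : R →ₗ[k] Z) (x : rightIdeal k e)
    (y : leftIdeal k e') :
    idealPairing ψ ((x : (rightBimod k e).X) ⊗ₜ[k] (y : (leftBimod k e').X)) = ψ (x.1 * y.1) :=
  rfl

/-- The linear map `x ⊗ y ↦ ψ (x y)`. -/
noncomputable def idealDesc {e e' : R} {Z : ModuleCat.{u} k} (ψ : R →ₗ[k] Z) :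
    ((rightBimod k e).tensorBimod (leftBimod k e')).X ⟶ Z :=
  bimodDesc (idealPairing ψ) fun (x : rightIdeal k e) (s : R) (y : leftIdeal k e') =>
    congrArg ψ (mul_assoc x.1 s y.1)

lemma idealDesc_tmul {e e' : R} {Z : ModuleCat.{u} k} (ψ : R →ₗ[k] Z) (x : rightIdeal k e)
    (y : leftIdeal k e') : idealDesc ψ (idealTmul x y) = ψ (x.1 * y.1) :=
  ConcreteCategory.congr_hom (bimodπ_desc (idealPairing ψ) _)
    ((x : (rightBimod k e).X) ⊗ₜ[k] (y : (leftBimod k e').X))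

lemma whiskerLeft_rightMul_tmul {d e e' : R} (t : R) (ht : t * e' = t) (x : rightIdeal k d)
    (y : leftIdeal k e) :
    (Bimod.whiskerLeft (rightBimod k d) (rightMul (k := k) (e := e) t ht)).hom (idealTmul x y) =
      idealTmul x ⟨y.1 * t, by
        change y.1 * t * e' = y.1 * t
        rw [mul_assoc, ht]⟩ :=
  ConcreteCategory.congr_hom
    (bimodπ_whiskerLeft (rightBimod k d) (rightMul (k := k) (e := e) t ht))
    ((x : (rightBimod k d).X) ⊗ₜ[k] (y : (leftBimod k e).X))

end Algebras

/-! ### The algebra `A_n` -/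

/-- The algebra `A_n` over `k`, with basis `e₀`, `e i`, `a i`, `b i`, `c` for `i` in `Fin n`:
an element is given by its coordinates. It is the quotient of the path algebra of the
double quiver of the star with centre `0` and `n` leaves, where the `e`s are the trivial
paths, `a i = e i * a i * e₀` and `b i = e₀ * b i * e i`, by the relations
`b i * a i = b j * a j` (this element is `c`) and `a i * b j = 0`. -/
@[ext]
structure StarQuiverAlgebra (k : Type u) (n : ℕ) : Type u where
  e₀ : k
  e : Fin n → k
  a : Fin n → k
  b : Fin n → k
  c : k

namespace StarQuiverAlgebra

variable {n : ℕ}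

instance : Zero (StarQuiverAlgebra k n) := ⟨⟨0, 0, 0, 0, 0⟩⟩
instance : One (StarQuiverAlgebra k n) := ⟨⟨1, 1, 0, 0, 0⟩⟩
instance : Add (StarQuiverAlgebra k n) :=
  ⟨fun x y => ⟨x.e₀ + y.e₀, x.e + y.e, x.a + y.a, x.b + y.b, x.c + y.c⟩⟩
instance : Neg (StarQuiverAlgebra k n) := ⟨fun x => ⟨-x.e₀, -x.e, -x.a, -x.b, -x.c⟩⟩
instance : SMul k (StarQuiverAlgebra k n) :=
  ⟨fun r x => ⟨r * x.e₀, r • x.e, r • x.a, r • x.b, r * x.c⟩⟩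
instance : Mul (StarQuiverAlgebra k n) := ⟨fun x y =>
  { e₀ := x.e₀ * y.e₀
    e := fun i => x.e i * y.e i
    a := fun i => x.e i * y.a i + x.a i * y.e₀
    b := fun i => x.e₀ * y.b i + x.b i * y.e i
    c := x.e₀ * y.c + x.c * y.e₀ + ∑ i, x.b i * y.a i }⟩

@[simp] lemma zero_e₀ : (0 : StarQuiverAlgebra k n).e₀ = 0 := rfl
@[simp] lemma zero_e : (0 : StarQuiverAlgebra k n).e = 0 := rfl
@[simp] lemma zero_a : (0 : StarQuiverAlgebra k n).a = 0 := rfl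
@[simp] lemma zero_b : (0 : StarQuiverAlgebra k n).b = 0 := rfl
@[simp] lemma zero_c : (0 : StarQuiverAlgebra k n).c = 0 := rfl
@[simp] lemma one_e₀ : (1 : StarQuiverAlgebra k n).e₀ = 1 := rfl
@[simp] lemma one_e : (1 : StarQuiverAlgebra k n).e = 1 := rfl
@[simp] lemma one_a : (1 : StarQuiverAlgebra k n).a = 0 := rfl
@[simp] lemma one_b : (1 : StarQuiverAlgebra k n).b = 0 := rfl
@[simp] lemma one_c : (1 : StarQuiverAlgebra k n).c = 0 := rfl

section
variable (x y : StarQuiverAlgebra k n) (r : k) (i : Fin n)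
@[simp] lemma add_e₀ : (x + y).e₀ = x.e₀ + y.e₀ := rfl
@[simp] lemma add_e : (x + y).e i = x.e i + y.e i := rfl
@[simp] lemma add_a : (x + y).a i = x.a i + y.a i := rfl
@[simp] lemma add_b : (x + y).b i = x.b i + y.b i := rfl
@[simp] lemma add_c : (x + y).c = x.c + y.c := rfl
@[simp] lemma neg_e₀ : (-x).e₀ = -x.e₀ := rfl
@[simp] lemma neg_e : (-x).e i = -x.e i := rfl
@[simp] lemma neg_a : (-x).a i = -x.a i := rfl
@[simp] lemma neg_b : (-x).b i = -x.b i := rfl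
@[simp] lemma neg_c : (-x).c = -x.c := rfl
@[simp] lemma smul_e₀ : (r • x).e₀ = r * x.e₀ := rfl
@[simp] lemma smul_e : (r • x).e i = r * x.e i := rfl
@[simp] lemma smul_a : (r • x).a i = r * x.a i := rfl
@[simp] lemma smul_b : (r • x).b i = r * x.b i := rfl
@[simp] lemma smul_c : (r • x).c = r * x.c := rfl
@[simp] lemma mul_e₀ : (x * y).e₀ = x.e₀ * y.e₀ := rfl
@[simp] lemma mul_e : (x * y).e i = x.e i * y.e i := rfl
@[simp] lemma mul_a : (x * y).a i = x.e i * y.a i + x.a i * y.e₀ := rfl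
@[simp] lemma mul_b : (x * y).b i = x.e₀ * y.b i + x.b i * y.e i := rfl
@[simp] lemma mul_c : (x * y).c = x.e₀ * y.c + x.c * y.e₀ + ∑ i, x.b i * y.a i := rfl
end

instance : Ring (StarQuiverAlgebra k n) where
  add_assoc x y z := by ext <;> simp [add_assoc]
  zero_add x := by ext <;> simp
  add_zero x := by ext <;> simp
  add_comm x y := by ext <;> simp [add_comm]
  neg_add_cancel x := by ext <;> simp
  zero_mul x := by ext <;> simp
  mul_zero x := by ext <;> simp
  one_mul x := by ext <;> simp
  mul_one x := by ext <;> simp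
  left_distrib x y z := by
    ext <;> simp only [mul_e₀, mul_e, mul_a, mul_b, mul_c, add_e₀, add_e, add_a, add_b, add_c,
      mul_add, Finset.sum_add_distrib] <;> ring
  right_distrib x y z := by
    ext <;> simp only [mul_e₀, mul_e, mul_a, mul_b, mul_c, add_e₀, add_e, add_a, add_b, add_c,
      add_mul, Finset.sum_add_distrib] <;> ring
  mul_assoc x y z := by
    ext
    · simp; ring
    · simp; ring
    · simp; ring
    · simp; ring
    · simp only [mul_c, mul_e₀, mul_b, mul_a, add_mul, mul_add, Finset.sum_add_distrib,
        Finset.sum_mul, Finset.mul_sum, mul_assoc]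
      ring
  nsmul := nsmulRec
  zsmul := zsmulRec

instance : Module k (StarQuiverAlgebra k n) where
  one_smul x := by ext <;> simp
  mul_smul r s x := by ext <;> simp [mul_assoc]
  smul_zero r := by ext <;> simp
  smul_add r x y := by ext <;> simp [mul_add]
  add_smul r s x := by ext <;> simp [add_mul]
  zero_smul x := by ext <;> simp

instance : Algebra k (StarQuiverAlgebra k n) :=
  Algebra.ofModule
    (fun r x y => by
      ext <;> simp [mul_add, Finset.mul_sum, mul_assoc])
    (fun r x y => by
      ext <;> simp [mul_add, Finset.mul_sum, mul_left_comm])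

instance : Module.Finite k (StarQuiverAlgebra k n) :=
  Module.Finite.of_injective
    ({ toFun := fun x => (x.e₀, x.e, x.a, x.b, x.c)
       map_add' := fun _ _ => rfl
       map_smul' := fun _ _ => rfl } :
      StarQuiverAlgebra k n →ₗ[k] k × (Fin n → k) × (Fin n → k) × (Fin n → k) × k)
    (fun x y h => by
      simp only [LinearMap.coe_mk, AddHom.coe_mk, Prod.mk.injEq] at h
      exact StarQuiverAlgebra.ext h.1 h.2.1 h.2.2.1 h.2.2.2.1 h.2.2.2.2)

variable (k)

/-- The vertices of the star: the centre `none` and the leaves `some i`. The idempotent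
belonging to a vertex. -/
def idem : Option (Fin n) → StarQuiverAlgebra k n
  | none => ⟨1, 0, 0, 0, 0⟩
  | some i => ⟨0, Pi.single i 1, 0, 0, 0⟩

/-- The basis element `a i`. -/
def arrowA (i : Fin n) : StarQuiverAlgebra k n := ⟨0, 0, Pi.single i 1, 0, 0⟩

/-- The basis element `b i`. -/
def arrowB (i : Fin n) : StarQuiverAlgebra k n := ⟨0, 0, 0, Pi.single i 1, 0⟩

lemma arrowA_mul_idem (i : Fin n) : arrowA k i * idem k none = arrowA k i := by
  ext <;> simp [arrowA, idem]

lemma arrowB_mul_arrowA (i : Fin n) : arrowB k i * arrowA k i = ⟨0, 0, 0, 0, 1⟩ := by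
  ext <;> simp [arrowA, arrowB, Pi.single_apply]

lemma idem_mul_idem (v : Option (Fin n)) : idem k v * idem k v = idem k v := by
  cases v <;> ext <;> simp [idem, Pi.single_apply]

lemma idem_mul_arrowA (i : Fin n) : idem k (some i) * arrowA k i = arrowA k i := by
  ext <;> simp [arrowA, idem, Pi.single_apply]

lemma idem_mul_arrowB (i : Fin n) : idem k none * arrowB k i = arrowB k i := by
  ext <;> simp [arrowB, idem]

lemma mul_right_idem {x y : StarQuiverAlgebra k n} {j : Fin n}
    (hx : idem k none * x = x) (hy : y * idem k (some j) = y) :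
    x * y = (x * y * arrowA k j).c • arrowB k j := by
  rw [← hx, ← hy]
  ext i <;> simp [arrowA, arrowB, idem, Pi.single_apply]
  split_ifs with h <;> simp [h]

lemma mul_arrowA {x y : StarQuiverAlgebra k n} {j : Fin n}
    (hx : idem k none * x = x) (hy : y * idem k (some j) = y) :
    x * (y * arrowA k j) = (x * y * arrowA k j).c • ⟨0, 0, 0, 0, 1⟩ := by
  rw [← mul_assoc, ← arrowB_mul_arrowA k j, ← smul_mul_assoc, ← mul_right_idem k hx hy]

/-- The linear functional `x ↦ x.c`. -/
def coeffC : StarQuiverAlgebra k n →ₗ[k] k where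
  toFun x := x.c
  map_add' _ _ := rfl
  map_smul' _ _ := rfl

end StarQuiverAlgebra

/-! ### The bicategory `B_n` and its birepresentations -/

namespace StarBirep

open StarQuiverAlgebra

variable (k : Type u) [Field k] (n : ℕ)

/-- The algebra `A_n` as an object of the bicategory of algebras and bimodules. -/
noncomputable abbrev alg : AlgBim k := algMon k (StarQuiverAlgebra k n)

/-- The ground field as an object of the bicategory of algebras and bimodules. -/
noncomputable abbrev pt : AlgBim k := algMon k k

variable {n}

/-- The projective left module `A e_v`. -/
noncomputable def proj (v : Option (Fin n)) : alg k n ⟶ pt k := leftBimod k (idem k v)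

variable (n) in
/-- The right module `e_0 A`. -/
noncomputable def coproj : pt k ⟶ alg k n := rightBimod k (idem k none)

/-- Right multiplication by `a i`, from `A e_i` to `A e_0`. -/
noncomputable def mulA (i : Fin n) : proj k (some i) ⟶ proj k (n := n) none :=
  rightMul (arrowA k i) (arrowA_mul_idem k i)

lemma coproj_comp_proj (v : Option (Fin n)) :
    addClosure (fun _ : Unit => 𝟙 (pt k)) (coproj k n ≫ proj k v) := by
  have : Module.Finite k (leftBimod k (idem k v)).X :=
    inferInstanceAs (Module.Finite k (leftIdeal k (idem k v)))
  have : Module.Finite k (rightBimod k (idem k (none : Option (Fin n)))).X :=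
    inferInstanceAs (Module.Finite k (rightIdeal k (idem k (none : Option (Fin n)))))
  have := bimod_tensor_finite (rightBimod k (idem k (none : Option (Fin n))))
    (leftBimod k (idem k v))
  exact @addClosure_regular _ _ _ this

/-- The map `x ⊗ y ↦ ψ (x y) b_j ⊗ e_j`, where `ψ` is the coefficient of `c`. -/
noncomputable def retr (j : Fin n) :
    coproj k n ≫ proj k none ⟶ coproj k n ≫ proj k (some j) :=
  mkScalarHom (M := (rightBimod k (idem k none)).tensorBimod (leftBimod k (idem k none)))
    (N := (rightBimod k (idem k none)).tensorBimod (leftBimod k (idem k (some j))))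
    (idealDesc (Z := ModuleCat.of k k) (coeffC k) ≫
      ModuleCat.ofHom (X := k) (LinearMap.toSpanSingleton k _
        (idealTmul ⟨arrowB k j, idem_mul_arrowB k j⟩ ⟨idem k (some j), idem_mul_idem k (some j)⟩)))

lemma retr_tmul (j : Fin n) (x : rightIdeal k (idem k (none : Option (Fin n))))
    (y : leftIdeal k (idem k (none : Option (Fin n)))) :
    (retr k j).hom (idealTmul x y) = (x.1 * y.1).c •
      idealTmul ⟨arrowB k j, idem_mul_arrowB k j⟩ ⟨idem k (some j), idem_mul_idem k (some j)⟩ := by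
  change (ModuleCat.ofHom (X := k) (LinearMap.toSpanSingleton k _ _))
    (idealDesc (Z := ModuleCat.of k k) (coeffC k) (idealTmul x y)) = _
  rw [idealDesc_tmul]
  rfl

/-- The element `y a_i` of `A e_0`, for `y` in `A e_i`. -/
def mulArrowA {i : Fin n} (y : leftIdeal k (idem k (some i))) :
    leftIdeal k (idem k (none : Option (Fin n))) :=
  ⟨y.1 * arrowA k i, by
    change y.1 * arrowA k i * idem k none = y.1 * arrowA k i
    rw [mul_assoc, arrowA_mul_idem]⟩

lemma whiskerLeft_mulA_tmul (i : Fin n) (x : rightIdeal k (idem k (none : Option (Fin n))))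
    (y : leftIdeal k (idem k (some i))) :
    (coproj k n ◁ mulA k i).hom (idealTmul x y) = idealTmul x (mulArrowA k y) :=
  whiskerLeft_rightMul_tmul (arrowA k i) (arrowA_mul_idem k i) x y

lemma idealTmul_eq {v : Option (Fin n)} (x : rightIdeal k (idem k (none : Option (Fin n))))
    (y : leftIdeal k (idem k v)) :
    idealTmul x y = idealTmul (rmulIdeal x y.1) ⟨idem k v, idem_mul_idem k v⟩ := by
  rw [idealTmul_balanced]
  exact congrArg (idealTmul x) (Subtype.ext y.2.symm)

lemma mulA_retr (j : Fin n) : coproj k n ◁ mulA k j ≫ retr k j = 𝟙 _ := by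
  refine Bimod.hom_ext _ _ (idealTmul_hom_ext fun x y => ?_)
  change (retr k j).hom ((coproj k n ◁ mulA k j).hom (idealTmul x y)) = idealTmul x y
  rw [whiskerLeft_mulA_tmul, retr_tmul, idealTmul_eq k x y]
  refine (idealTmul_smul _ _ _).symm.trans ?_
  refine congrArg (idealTmul · _) (Subtype.ext ?_)
  change (x.1 * (y.1 * arrowA k j)).c • arrowB k j = x.1 * y.1
  rw [← mul_assoc, ← mul_right_idem k x.2 y.2]

lemma mulA_retr_mulA (i j : Fin n) :
    coproj k n ◁ mulA k i ≫ retr k j ≫ coproj k n ◁ mulA k j = coproj k n ◁ mulA k i := by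
  refine Bimod.hom_ext _ _ (idealTmul_hom_ext fun x y => ?_)
  change (coproj k n ◁ mulA k j).hom ((retr k j).hom ((coproj k n ◁ mulA k i).hom
    (idealTmul x y))) = (coproj k n ◁ mulA k i).hom (idealTmul x y)
  rw [whiskerLeft_mulA_tmul, retr_tmul]
  refine (map_smul (coproj k n ◁ mulA k j).hom.hom _ _).trans ?_
  refine (congrArg (_ • ·) (whiskerLeft_mulA_tmul k j _ _)).trans ?_
  rw [idealTmul_eq k x (mulArrowA k y), idealTmul_eq]
  refine (idealTmul_smul _ _ _).symm.trans ?_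
  refine congrArg (idealTmul · _) (Subtype.ext ?_)
  change (x.1 * (y.1 * arrowA k i)).c • (arrowB k j * (idem k (some j) * arrowA k j)) =
    x.1 * (y.1 * arrowA k i)
  rw [idem_mul_arrowA, arrowB_mul_arrowA, mul_arrowA k x.2 y.2, mul_assoc]
  simp

end StarBirep

section Generators

variable {𝔐 : Type (u + 1)} [Bicategory.{u, u + 1} 𝔐] [PreadditiveBicategory 𝔐]
  {x y a z : 𝔐}

lemma addClosure.map {C D : Type*} [Category C] [Category D] [Preadditive C] [Preadditive D]
    {ι κ : Type*} {X : ι → C} {Y : κ → D} (F : C ⥤ D) [F.Additive]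
    (h : ∀ i, addClosure Y (F.obj (X i))) {M : C} (hM : addClosure X M) :
    addClosure Y (F.obj M) := by
  obtain ⟨m, i, p, q, hpq⟩ := hM
  refine addClosure.of_sum (fun t => h (i t)) (fun t => F.map (p t)) (fun t => F.map (q t)) ?_
  rw [← F.map_id, ← hpq, F.map_sum]
  exact Finset.sum_congr rfl fun t _ => (F.map_comp _ _).symm

lemma addClosure.comp_left {ι κ : Type*} {X : ι → (x ⟶ y)} {Y : κ → (a ⟶ y)} (L : a ⟶ x)
    (h : ∀ i, addClosure Y (L ≫ X i)) {M : x ⟶ y} (hM : addClosure X M) :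
    addClosure Y (L ≫ M) :=
  have : (precomp y L).Additive := ⟨PreadditiveBicategory.whiskerLeft_add _ _ _⟩
  addClosure.map (precomp y L) h hM

lemma addClosure.comp_right {ι κ : Type*} {X : ι → (x ⟶ y)} {Y : κ → (x ⟶ a)} (R : y ⟶ a)
    (h : ∀ i, addClosure Y (X i ≫ R)) {M : x ⟶ y} (hM : addClosure X M) :
    addClosure Y (M ≫ R) :=
  have : (postcomp x R).Additive := ⟨PreadditiveBicategory.add_whiskerRight _ _ _⟩
  addClosure.map (postcomp x R) h hM

variable {V : Type*} {P : V → (a ⟶ z)} {Q : z ⟶ a}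

/-- The 1-morphisms `𝟙 a` and `P v ≫ Q`. -/
def generators (P : V → (a ⟶ z)) (Q : z ⟶ a) : Option V → (a ⟶ a)
  | none => 𝟙 a
  | some v => P v ≫ Q

lemma generators_act_left (hQ : ∀ v, addClosure (fun _ : Unit => 𝟙 z) (Q ≫ P v))
    {M : a ⟶ a} {X : a ⟶ z} (hM : addClosure (generators P Q) M) (hX : addClosure P X) :
    addClosure P (M ≫ X) := by
  refine addClosure.comp_right X (fun i => ?_) hM
  refine addClosure.comp_left _ (fun v => ?_) hX
  cases i with
  | none => exact addClosure.of_iso (λ_ (P v)) (addClosure.self v)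
  | some w =>
    exact addClosure.of_iso (α_ (P w) Q (P v)) <| addClosure.comp_left (P w)
      (fun _ => addClosure.of_iso (ρ_ (P w)) (addClosure.self w)) (hQ v)

lemma generators_act_ideal (hQ : ∀ v, addClosure (fun _ : Unit => 𝟙 z) (Q ≫ P v))
    {M X : a ⟶ a} (hM : addClosure (generators P Q) M)
    (hX : addClosure (fun v => P v ≫ Q) X) : addClosure (fun v => P v ≫ Q) (M ≫ X) := by
  refine addClosure.comp_left _ (fun v => ?_) hX
  exact addClosure.of_iso (α_ M (P v) Q).symm <| addClosure.comp_right Q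
    (fun w => addClosure.self w) (generators_act_left hQ hM (addClosure.self v))

lemma generators_le : addClosure (fun v => P v ≫ Q) ≤ addClosure (generators P Q) :=
  fun _ ⟨m, i, p, q, h⟩ => ⟨m, fun t => some (i t), p, q, h⟩

lemma generators_comp (hQ : ∀ v, addClosure (fun _ : Unit => 𝟙 z) (Q ≫ P v))
    {M N : a ⟶ a} (hM : addClosure (generators P Q) M) (hN : addClosure (generators P Q) N) :
    addClosure (generators P Q) (M ≫ N) := by
  refine addClosure.comp_left _ (fun i => ?_) hN
  cases i with
  | none => exact addClosure.of_iso (ρ_ M) hM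
  | some v => exact generators_le _ (generators_act_ideal hQ hM (addClosure.self v))

end Generators

namespace StarBirep

variable (k : Type u) [Field k] (n : ℕ)

/-- The 1-morphisms of `B_n`: the bimodules in `add {A, A e_v ⊗ e_0 A}`. -/
noncomputable def endClass : EndClass (alg k n) where
  prop := addClosure (generators (proj k) (coproj k n))
  id := addClosure.self (X := generators (proj k) (coproj k n)) none
  comp := generators_comp (coproj_comp_proj k)

/-- The bicategory `B_n`: it has one object, its 1-morphisms are the `A`-`A`-bimodules in
`add {A, A e_v ⊗ e_0 A}`, composed by the tensor product over `A`, and its 2-morphisms are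
the bimodule homomorphisms. -/
abbrev Bicat : Type := Deloop (endClass k n)

/-- The bimodules in `add {A e_v ⊗ e_0 A}`. -/
noncomputable def idealClass : StableClass (endClass k n) (alg k n) where
  prop := addClosure fun v => proj k v ≫ coproj k n
  act := generators_act_ideal (coproj_comp_proj k)

/-- The finitely generated projective left `A`-modules, that is, the modules in `add {A e_v}`. -/
noncomputable def projClass : StableClass (endClass k n) (pt k) where
  prop := addClosure (proj k (n := n))
  act := generators_act_left (coproj_comp_proj k)

lemma idealClass_le : (idealClass k n).prop ≤ (endClass k n).stable.prop :=
  generators_le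

/-- The principal birepresentation `P = B_n(i, -)`. -/
noncomputable def repP : LinRep.{u, u + 1} k (Bicat k n) := (endClass k n).stable.rep k

/-- The subbirepresentation `N` of `P` on `add {A e_v ⊗ e_0 A}`. -/
noncomputable def repN : LinRep.{u, u + 1} k (Bicat k n) := (idealClass k n).rep k

/-- The cell birepresentation `C`: the finitely generated projective left `A`-modules, on which
a bimodule `M` acts by `M ⊗ -`. -/
noncomputable def repC : LinRep.{u, u + 1} k (Bicat k n) := (projClass k n).rep k

/-- The inclusion `Γ` of `N` in `P`. -/
noncomputable def incl : repN k n ⟶ repP k n := StableClass.incl k (idealClass_le k n)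

variable {n}

/-- The strong transformation `Θ_i = - ⊗ A e_i` from `P` to `C`, for a leaf `i`. -/
noncomputable def theta (i : Fin n) : repP k n ⟶ repC k n :=
  (projClass k n).yoneda k ⟨proj k (some i), addClosure.self _⟩

/-- The modification `s_{i,j}` from `Θ_i ∘ Γ` to `Θ_j ∘ Γ`: its component at `M` is the unique
homomorphism `M ⊗ A e_i ⟶ M ⊗ A e_j` whose composite with right multiplication by `a_j`,
from `M ⊗ A e_j` to `M ⊗ A e_0`, is right multiplication by `a_i`. -/
noncomputable def modif (i j : Fin n) : incl k n ≫ theta k i ⟶ incl k n ≫ theta k j :=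
  StableClass.transport (X := fun i => ⟨proj k (some i), addClosure.self _⟩) (ρ := mulA k) k
    (idealClass_le k n) (fun _ hM => Transports.of_addClosure (fun v =>
      Transports.comp_of_retraction (retr k) (mulA_retr k) (mulA_retr_mulA k) (proj k v)) hM) i j

end StarBirep

open StarBirep

/-- The colimits that define `C^W(𝔓)` and `C^WR(𝔓)`. A set partition `𝔓` of the set of leaves is
given by an equivalence relation. -/
structure WRColimit (k : Type u) [Field k] (n : ℕ) (𝔓 : Setoid (Fin n)) where
  /-- The birepresentation `C^W(𝔓)`. -/
  CW : LinRep.{u, u + 1} k (Bicat k n)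
  /-- The strong transformation `Ω^W(𝔓)` from `C` to `C^W(𝔓)` with the invertible
  modifications `Ω^W ∘ Θ_i ≅ Ω^W ∘ Θ_j` for `i` and `j` in the same block. -/
  cocone : IsoCocone (theta k) 𝔓 CW
  isBicolimit : cocone.IsBicolimit
  /-- The birepresentation `C^WR(𝔓)`. -/
  CWR : LinRep.{u, u + 1} k (Bicat k n)
  /-- The strong transformation `Ω^R(𝔓)`, the coequifier, for all `i` and `j` in the same block, of
  the restriction to `N` of `Ω^W ∘ Θ_i ≅ Ω^W ∘ Θ_j` and of `Ω^W` applied to `s_{i,j}`. -/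
  ΩR : CW ⟶ CWR
  isCoequifier : IsCoequifier (ι := {p : Fin n × Fin n // 𝔓 p.1 p.2})
    (a := fun _ => repN k n)
    (f := fun p => incl k n ≫ theta k p.1.1 ≫ cocone.leg)
    (g := fun p => incl k n ≫ theta k p.1.2 ≫ cocone.leg)
    (fun p => incl k n ◁ (cocone.iso p.2).hom)
    (fun p => (α_ (incl k n) (theta k p.1.1) cocone.leg).inv ≫
      modif k p.1.1 p.1.2 ▷ cocone.leg ≫ (α_ (incl k n) (theta k p.1.2) cocone.leg).hom) ΩR

/-- The strong transformation `Ω^WR(𝔓) = Ω^R(𝔓) ∘ Ω^W(𝔓)` from `C` to `C^WR(𝔓)`. -/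
noncomputable def WRColimit.ΩWR {k : Type u} [Field k] {n : ℕ} {𝔓 : Setoid (Fin n)} (X : WRColimit k n 𝔓) :
    repC k n ⟶ X.CWR :=
  X.cocone.leg ≫ X.ΩR

end BiRep

/-!
The colimits exist because the bicategory of birepresentations has all coisoinserters and
coequifiers, and the comparison transformations come from their universal properties.

*Existence.* In the bicategory of linear birepresentations of any linear bicategory, iterated
coisoinserters (`LinRep.isBicolimit_coinserterCocone`) and coequifiers
(`LinRep.exists_isCoequifier`) are built by generators and relations. The colimit of a diagram
with target `b` has the same objects as `b`. Its morphisms are formal expressions in the morphisms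
of `b` and in the new generators: for the coisoinserter of the `f i` these are morphisms `f i A ⟶
f j A`, and for a coequifier there are none. Two expressions are identified if they have the same
value in every model, where the models are all cocones, or all 1-morphisms that coequify the given
pairs, with arbitrary vertex. The evaluations at the models are thus jointly faithful by
construction. So every identity between morphisms of the colimit can be checked in the models,
where it is known, and no explicit list of relations is needed. This works as soon as the action
on a generator is again an expression with the correct values, which is what a
`LinRep.Presentation` records. The coherence laws of the presented birepresentation are images of
those of `b`. Each model extends to the colimit by evaluation (`LinRep.Presentation.projDescIso`),
and a modification extends as soon as it is natural with respect to the generators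
(`LinRep.Presentation.exists_whiskerLeft_proj`).

*Comparison.* The two universal properties combine to one: a 1-morphism out of `C^WR(𝔓)` is the
same as a cocone over `𝔓` whose isomorphisms restrict on `N` to the modifications `s_{i,j}`
(`WRColimit.exists_postcomp_iso`, `WRColimit.nonempty_iso`). If `𝔓` refines `𝔓'`, the universal
cocone over `𝔓'` restricts to such a cocone over `𝔓`, and this defines the comparison
transformation. Both sides of the composition law induce the same cocone up to isomorphism, hence
are isomorphic.
-/

namespace BiRep

variable {k : Type u} [Field k]

/-! ### Birepresentations in terms of objects and morphisms -/

namespace LinRep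

variable {𝔅 : Type*} [Bicategory 𝔅] [PreadditiveBicategory 𝔅] [LinearBicategory k 𝔅]

section

variable (R : LinRep.{u, v} k 𝔅)

/-- The underlying pseudofunctor of a birepresentation. -/
abbrev pseudo : 𝔅 ⥤ᵖ LinCat.{u, v} k := LinPseudofunctor.toPseudofunctor R

/-- The category of a birepresentation at an object `s` of the bicategory. -/
abbrev cat (s : 𝔅) : Type v := ((pseudo R).obj s).carrier

variable {s t r q : 𝔅}

/-- The functor by which a 1-morphism acts. -/
abbrev act (F : s ⟶ t) : cat R s ⥤ cat R t := LinFunctor.functor ((pseudo R).map F)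

/-- The natural transformation by which a 2-morphism acts. -/
abbrev act₂ {F G : s ⟶ t} (η : F ⟶ G) : act R F ⟶ act R G := ((pseudo R).map₂ η).nat

/-- The components of the unit constraint `act (𝟙 s) ≅ 𝟭`. -/
def actId (s : 𝔅) (X : cat R s) : (act R (𝟙 s)).obj X ≅ X where
  hom := ((pseudo R).mapId s).hom.nat.app X
  inv := ((pseudo R).mapId s).inv.nat.app X
  hom_inv_id := congrArg (fun α => (LinFunctor.Hom.nat α).app X) ((pseudo R).mapId s).hom_inv_id
  inv_hom_id := congrArg (fun α => (LinFunctor.Hom.nat α).app X) ((pseudo R).mapId s).inv_hom_id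

/-- The components of the composition constraint `act (F ≫ G) ≅ act F ⋙ act G`. -/
def actComp (F : s ⟶ t) (G : t ⟶ r) (X : cat R s) :
    (act R (F ≫ G)).obj X ≅ (act R G).obj ((act R F).obj X) where
  hom := ((pseudo R).mapComp F G).hom.nat.app X
  inv := ((pseudo R).mapComp F G).inv.nat.app X
  hom_inv_id := congrArg (fun α => (LinFunctor.Hom.nat α).app X)
    ((pseudo R).mapComp F G).hom_inv_id
  inv_hom_id := congrArg (fun α => (LinFunctor.Hom.nat α).app X)
    ((pseudo R).mapComp F G).inv_hom_id

lemma actId_naturality {X Y : cat R s} (f : X ⟶ Y) :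
    (act R (𝟙 s)).map f ≫ (actId R s Y).hom = (actId R s X).hom ≫ f :=
  ((pseudo R).mapId s).hom.nat.naturality f

lemma actComp_naturality (F : s ⟶ t) (G : t ⟶ r) {X Y : cat R s} (f : X ⟶ Y) :
    (act R (F ≫ G)).map f ≫ (actComp R F G Y).hom =
      (actComp R F G X).hom ≫ (act R G).map ((act R F).map f) :=
  ((pseudo R).mapComp F G).hom.nat.naturality f

lemma act₂_id_app (F : s ⟶ t) (X : cat R s) : (act₂ R (𝟙 F)).app X = 𝟙 _ :=
  congrArg (fun α => (LinFunctor.Hom.nat α).app X) ((pseudo R).map₂_id F)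

lemma act₂_comp_app {F G H : s ⟶ t} (η : F ⟶ G) (θ : G ⟶ H) (X : cat R s) :
    (act₂ R (η ≫ θ)).app X = (act₂ R η).app X ≫ (act₂ R θ).app X :=
  congrArg (fun α => (LinFunctor.Hom.nat α).app X) ((pseudo R).map₂_comp η θ)

lemma act₂_whiskerLeft_app (F : s ⟶ t) {G H : t ⟶ r} (η : G ⟶ H) (X : cat R s) :
    (act₂ R (F ◁ η)).app X =
      (actComp R F G X).hom ≫ (act₂ R η).app ((act R F).obj X) ≫ (actComp R F H X).inv :=
  congrArg (fun α => (LinFunctor.Hom.nat α).app X) ((pseudo R).map₂_whisker_left F η)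

lemma act₂_whiskerRight_app {F G : s ⟶ t} (η : F ⟶ G) (H : t ⟶ r) (X : cat R s) :
    (act₂ R (η ▷ H)).app X =
      (actComp R F H X).hom ≫ (act R H).map ((act₂ R η).app X) ≫ (actComp R G H X).inv :=
  congrArg (fun α => (LinFunctor.Hom.nat α).app X) ((pseudo R).map₂_whisker_right η H)

lemma act₂_associator_app (F : s ⟶ t) (G : t ⟶ r) (H : r ⟶ q) (X : cat R s) :
    (act₂ R (α_ F G H).hom).app X =
      (actComp R (F ≫ G) H X).hom ≫ (act R H).map (actComp R F G X).hom ≫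
        (actComp R G H ((act R F).obj X)).inv ≫ (actComp R F (G ≫ H) X).inv :=
  (congrArg (fun α => (LinFunctor.Hom.nat α).app X) ((pseudo R).map₂_associator F G H)).trans <|
    show (actComp R (F ≫ G) H X).hom ≫ (act R H).map (actComp R F G X).hom ≫ 𝟙 _ ≫
        (actComp R G H ((act R F).obj X)).inv ≫ (actComp R F (G ≫ H) X).inv = _ by
      rw [Category.id_comp]

lemma act₂_leftUnitor_app (F : s ⟶ t) (X : cat R s) :
    (act₂ R (λ_ F).hom).app X = (actComp R (𝟙 s) F X).hom ≫ (act R F).map (actId R s X).hom :=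
  (congrArg (fun α => (LinFunctor.Hom.nat α).app X) ((pseudo R).map₂_left_unitor F)).trans <|
    show (actComp R (𝟙 s) F X).hom ≫ (act R F).map (actId R s X).hom ≫ 𝟙 _ = _ by
      rw [Category.comp_id]

lemma act₂_rightUnitor_app (F : s ⟶ t) (X : cat R s) :
    (act₂ R (ρ_ F).hom).app X =
      (actComp R F (𝟙 t) X).hom ≫ (actId R t ((act R F).obj X)).hom :=
  (congrArg (fun α => (LinFunctor.Hom.nat α).app X) ((pseudo R).map₂_right_unitor F)).trans <|
    show (actComp R F (𝟙 t) X).hom ≫ (actId R t ((act R F).obj X)).hom ≫ 𝟙 _ = _ by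
      rw [Category.comp_id]

lemma act₂_add_app {F G : s ⟶ t} (η θ : F ⟶ G) (X : cat R s) :
    (act₂ R (η + θ)).app X = (act₂ R η).app X + (act₂ R θ).app X :=
  congrArg (fun α => (LinFunctor.Hom.nat α).app X) (LinPseudofunctor.map₂_add R η θ)

lemma act₂_smul_app {F G : s ⟶ t} (c : k) (η : F ⟶ G) (X : cat R s) :
    (act₂ R (c • η)).app X = c • (act₂ R η).app X :=
  congrArg (fun α => (LinFunctor.Hom.nat α).app X) (LinPseudofunctor.map₂_smul R c η)

end

section

variable {R R' R'' : LinRep.{u, v} k 𝔅} {s t r : 𝔅}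

/-- The functors underlying a strong transformation. -/
abbrev fn (f : R ⟶ R') (s : 𝔅) : cat R s ⥤ cat R' s := LinFunctor.functor (f.hom.app s)

/-- The components of the constraint `act F ⋙ fn f t ≅ fn f s ⋙ act F` of a strong
transformation. -/
def constraint (f : R ⟶ R') (F : s ⟶ t) (X : cat R s) :
    (fn f t).obj ((act R F).obj X) ≅ (act R' F).obj ((fn f s).obj X) where
  hom := (f.hom.naturality F).hom.nat.app X
  inv := (f.hom.naturality F).inv.nat.app X
  hom_inv_id := congrArg (fun α => (LinFunctor.Hom.nat α).app X) (f.hom.naturality F).hom_inv_id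
  inv_hom_id := congrArg (fun α => (LinFunctor.Hom.nat α).app X) (f.hom.naturality F).inv_hom_id

lemma constraint_naturality (f : R ⟶ R') (F : s ⟶ t) {X Y : cat R s} (φ : X ⟶ Y) :
    (fn f t).map ((act R F).map φ) ≫ (constraint f F Y).hom =
      (constraint f F X).hom ≫ (act R' F).map ((fn f s).map φ) :=
  (f.hom.naturality F).hom.nat.naturality φ

lemma constraint_act₂ (f : R ⟶ R') {F G : s ⟶ t} (η : F ⟶ G) (X : cat R s) :
    (fn f t).map ((act₂ R η).app X) ≫ (constraint f G X).hom =
      (constraint f F X).hom ≫ (act₂ R' η).app ((fn f s).obj X) :=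
  congrArg (fun α => (LinFunctor.Hom.nat α).app X) (f.hom.naturality_naturality η)

lemma constraint_id (f : R ⟶ R') (X : cat R s) :
    (constraint f (𝟙 s) X).hom ≫ (actId R' s ((fn f s).obj X)).hom =
      (fn f s).map (actId R s X).hom :=
  (congrArg (fun α => (LinFunctor.Hom.nat α).app X) (f.hom.naturality_id s)).trans <|
    show (fn f s).map (actId R s X).hom ≫ 𝟙 _ ≫ 𝟙 _ = _ by rw [Category.comp_id, Category.comp_id]

lemma constraint_comp (f : R ⟶ R') (F : s ⟶ t) (G : t ⟶ r) (X : cat R s) :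
    (constraint f (F ≫ G) X).hom ≫ (actComp R' F G ((fn f s).obj X)).hom =
      (fn f r).map (actComp R F G X).hom ≫ (constraint f G ((act R F).obj X)).hom ≫
        (act R' G).map (constraint f F X).hom :=
  (congrArg (fun α => (LinFunctor.Hom.nat α).app X) (f.hom.naturality_comp F G)).trans <|
    show (fn f r).map (actComp R F G X).hom ≫ 𝟙 _ ≫ (constraint f G ((act R F).obj X)).hom ≫
        𝟙 _ ≫ (act R' G).map (constraint f F X).hom ≫ 𝟙 _ = _ by
      rw [Category.id_comp, Category.id_comp, Category.comp_id]

/-- The natural transformations underlying a modification. -/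
abbrev cell {f g : R ⟶ R'} (α : f ⟶ g) (s : 𝔅) : fn f s ⟶ fn g s := (α.hom.as.app s).nat

lemma cell_constraint {f g : R ⟶ R'} (α : f ⟶ g) (F : s ⟶ t) (X : cat R s) :
    (cell α t).app ((act R F).obj X) ≫ (constraint g F X).hom =
      (constraint f F X).hom ≫ (act R' F).map ((cell α s).app X) :=
  congrArg (fun β => (LinFunctor.Hom.nat β).app X) (α.hom.as.naturality F)

@[ext]
lemma cell_ext {f g : R ⟶ R'} {α β : f ⟶ g} (h : ∀ s X, (cell α s).app X = (cell β s).app X) :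
    α = β :=
  InducedBicategory.hom₂_ext <| Pseudofunctor.StrongTrans.homCategory.ext fun s =>
    LinCat.hom_ext (h s)

lemma constraint_comp_hom (f : R ⟶ R') (g : R' ⟶ R'') (F : s ⟶ t) (X : cat R s) :
    (constraint (f ≫ g) F X).hom =
      (fn g t).map (constraint f F X).hom ≫ (constraint g F ((fn f s).obj X)).hom :=
  show 𝟙 _ ≫ (fn g t).map (constraint f F X).hom ≫ 𝟙 _ ≫
    (constraint g F ((fn f s).obj X)).hom ≫ 𝟙 _ = _ by simp

/-- A modification from its components. -/
def mkCell {f g : R ⟶ R'} (α : ∀ s, fn f s ⟶ fn g s)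
    (h : ∀ {s t : 𝔅} (F : s ⟶ t) (X : cat R s),
      (α t).app ((act R F).obj X) ≫ (constraint g F X).hom =
        (constraint f F X).hom ≫ (act R' F).map ((α s).app X)) : f ⟶ g :=
  ⟨⟨{ app := fun s => ⟨α s⟩
      naturality := fun F => LinCat.hom_ext fun X => h F X }⟩⟩

/-- An invertible modification from its components. -/
def mkCellIso {f g : R ⟶ R'} (α : ∀ s, fn f s ≅ fn g s)
    (h : ∀ {s t : 𝔅} (F : s ⟶ t) (X : cat R s),
      (α t).hom.app ((act R F).obj X) ≫ (constraint g F X).hom =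
        (constraint f F X).hom ≫ (act R' F).map ((α s).hom.app X)) : f ≅ g where
  hom := mkCell (fun s => (α s).hom) h
  inv := mkCell (fun s => (α s).inv) fun {s t} F X => by
    rw [← cancel_epi ((α t).hom.app ((act R F).obj X)), Iso.hom_inv_id_app_assoc, ← Category.assoc,
      h, Category.assoc, ← Functor.map_comp, Iso.hom_inv_id_app]
    exact ((congrArg _ ((act R' F).map_id _)).trans (Category.comp_id _)).symm
  hom_inv_id := cell_ext fun s X => (α s).hom_inv_id_app X
  inv_hom_id := cell_ext fun s X => (α s).inv_hom_id_app X

/-- A strong transformation from its components. -/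
def mkTrans (fn' : ∀ s, LinFunctor ((pseudo R).obj s) ((pseudo R').obj s))
    (con : ∀ {s t : 𝔅} (F : s ⟶ t), act R F ⋙ (fn' t).functor ≅ (fn' s).functor ⋙ act R' F)
    (con_act₂ : ∀ {s t : 𝔅} {F G : s ⟶ t} (η : F ⟶ G) (X : cat R s),
      (fn' t).functor.map ((act₂ R η).app X) ≫ (con G).hom.app X =
        (con F).hom.app X ≫ (act₂ R' η).app ((fn' s).functor.obj X))
    (con_id : ∀ (s : 𝔅) (X : cat R s),
      (con (𝟙 s)).hom.app X ≫ (actId R' s ((fn' s).functor.obj X)).hom =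
        (fn' s).functor.map (actId R s X).hom)
    (con_comp : ∀ {s t r : 𝔅} (F : s ⟶ t) (G : t ⟶ r) (X : cat R s),
      (con (F ≫ G)).hom.app X ≫ (actComp R' F G ((fn' s).functor.obj X)).hom =
        (fn' r).functor.map (actComp R F G X).hom ≫ (con G).hom.app ((act R F).obj X) ≫
          (act R' G).map ((con F).hom.app X)) : R ⟶ R' :=
  InducedBicategory.mkHom (F := LinPseudofunctor.toPseudofunctor) (X := R) (Y := R')
  { app := fn'
    naturality := fun {s t} F => LinCat.isoMk (con F)
    naturality_naturality := fun η => LinCat.hom_ext fun X => con_act₂ η X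
    naturality_id := fun s => LinCat.hom_ext fun X => (con_id s X).trans <|
      show (fn' s).functor.map (actId R s X).hom =
          (fn' s).functor.map (actId R s X).hom ≫ 𝟙 _ ≫ 𝟙 _ by
        rw [Category.comp_id, Category.comp_id]
    naturality_comp := fun {s t r} F G => LinCat.hom_ext fun X => (con_comp F G X).trans <|
      show _ = (fn' r).functor.map (actComp R F G X).hom ≫ 𝟙 _ ≫
          (con G).hom.app ((act R F).obj X) ≫ 𝟙 _ ≫ (act R' G).map ((con F).hom.app X) ≫ 𝟙 _ by
        rw [Category.id_comp, Category.id_comp, Category.comp_id] }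

end

end LinRep

/-! ### Adjoining morphisms to a linear category -/

/-- The formal expressions in the morphisms of a category `C` and in new generators `G X Y`. Scalar
multiples need no constructor: they are composites with multiples of identities of `C`. -/
inductive Expr {C : Type v} [Category.{v} C] (G : C → C → Type v) : C → C → Type v
  | of {X Y : C} (f : X ⟶ Y) : Expr G X Y
  | gen {X Y : C} (g : G X Y) : Expr G X Y
  | comp {X Y Z : C} (p : Expr G X Y) (q : Expr G Y Z) : Expr G X Z
  | add {X Y : C} (p q : Expr G X Y) : Expr G X Y

namespace Expr

variable {C : Type v} [Category.{v} C] {G : C → C → Type v}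

/-- The value of an expression under a functor and an assignment of morphisms to the generators. -/
def eval {D : Type w} [Category.{w} D] [Preadditive D] (F : C ⥤ D)
    (γ : ∀ {X Y : C}, G X Y → (F.obj X ⟶ F.obj Y)) {X Y : C} :
    Expr G X Y → (F.obj X ⟶ F.obj Y)
  | of f => F.map f
  | gen g => γ g
  | comp p q => p.eval F γ ≫ q.eval F γ
  | add p q => p.eval F γ + q.eval F γ

/-- The image of an expression under a functor and an assignment of expressions to the
generators. -/
def map {C' : Type v} [Category.{v} C'] {G' : C' → C' → Type v} (Φ : C ⥤ C')
    (γ : ∀ {X Y : C}, G X Y → Expr G' (Φ.obj X) (Φ.obj Y)) {X Y : C} :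
    Expr G X Y → Expr G' (Φ.obj X) (Φ.obj Y)
  | of f => of (Φ.map f)
  | gen g => γ g
  | comp p q => comp (p.map Φ γ) (q.map Φ γ)
  | add p q => add (p.map Φ γ) (q.map Φ γ)

/-- A square of functors that commutes up to a natural transformation on morphisms of `C` and on
generators commutes on all expressions. -/
lemma eval_map_comp {C' : Type v} [Category.{v} C'] {G' : C' → C' → Type v} {Φ : C ⥤ C'}
    {γ : ∀ {X Y : C}, G X Y → Expr G' (Φ.obj X) (Φ.obj Y)}
    {D D' : Type w} [Category.{w} D] [Preadditive D] [Category.{w} D'] [Preadditive D']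
    {F : C ⥤ D} {δ : ∀ {X Y : C}, G X Y → (F.obj X ⟶ F.obj Y)}
    {F' : C' ⥤ D'} {δ' : ∀ {X Y : C'}, G' X Y → (F'.obj X ⟶ F'.obj Y)}
    {Ψ : D ⥤ D'} [Ψ.Additive] (ν : ∀ X, F'.obj (Φ.obj X) ⟶ Ψ.obj (F.obj X))
    (hof : ∀ {X Y : C} (f : X ⟶ Y), F'.map (Φ.map f) ≫ ν Y = ν X ≫ Ψ.map (F.map f))
    (hgen : ∀ {X Y : C} (g : G X Y), (γ g).eval F' δ' ≫ ν Y = ν X ≫ Ψ.map (δ g))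
    {X Y : C} (p : Expr G X Y) :
    (p.map Φ γ).eval F' δ' ≫ ν Y = ν X ≫ Ψ.map (p.eval F δ) := by
  induction p with
  | of f => exact hof f
  | gen g => exact hgen g
  | comp p q hp hq =>
    simp only [map, eval, Category.assoc, Functor.map_comp]
    rw [hq, ← Category.assoc, hp, Category.assoc]
  | add p q hp hq =>
    simp only [map, eval, Functor.map_add, Preadditive.add_comp, Preadditive.comp_add, hp, hq]

end Expr

/-- A linear functor from `C` together with images of the generators `G X Y`. -/
structure Interp (k : Type u) [Field k] {C : Type v} [Category.{v} C] [Preadditive C] [Linear k C]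
    (G : C → C → Type v) where
  target : LinCat.{u, v} k
  functor : C ⥤ target.carrier
  [additive : functor.Additive]
  [linear : functor.Linear k]
  gen : ∀ {X Y : C}, G X Y → (functor.obj X ⟶ functor.obj Y)

attribute [instance] Interp.additive Interp.linear

section Adjoined

variable {C : Type v} [Category.{v} C] [Preadditive C] [Linear k C] {G : C → C → Type v}
  {M : Type*}

/-- The value of an expression under an interpretation. -/
abbrev Interp.eval (I : Interp k G) {X Y : C} (p : Expr G X Y) :
    I.functor.obj X ⟶ I.functor.obj Y :=
  p.eval I.functor I.gen

/-- The category obtained from `C` by adjoining the generators `G X Y`, subject to all the relations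
that hold in each interpretation of the family `I`. This is its type of objects, which are those
of `C`. -/
structure Adjoined (I : M → Interp k G) : Type v where
  obj : C

namespace Adjoined

/-- Two expressions are identified if they have the same value in each interpretation. -/
def setoid (I : M → Interp k G) (X Y : C) : Setoid (Expr G X Y) where
  r p q := ∀ m, (I m).eval p = (I m).eval q
  iseqv := ⟨fun _ _ => rfl, fun h m => (h m).symm, fun h h' m => (h m).trans (h' m)⟩

variable {I : M → Interp k G}

lemma setoid_iff {X Y : C} {p q : Expr G X Y} :
    (setoid I X Y) p q ↔ ∀ m, (I m).eval p = (I m).eval q := Iff.rfl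

instance : CategoryStruct (Adjoined I) where
  Hom X Y := Quotient (setoid I X.obj Y.obj)
  id X := Quotient.mk _ (.of (𝟙 X.obj))
  comp f g := Quotient.map₂ .comp (fun _ _ h _ _ h' m =>
    congrArg₂ (· ≫ ·) (setoid_iff.1 h m) (setoid_iff.1 h' m)) f g

/-- The morphism given by an expression. -/
def ofExpr (I : M → Interp k G) {X Y : C} (p : Expr G X Y) : (⟨X⟩ : Adjoined I) ⟶ ⟨Y⟩ :=
  Quotient.mk _ p

/-- The value of a morphism under an interpretation. -/
def eval (m : M) {X Y : Adjoined I} (f : X ⟶ Y) :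
    (I m).functor.obj X.obj ⟶ (I m).functor.obj Y.obj :=
  Quotient.lift (fun p => (I m).eval p) (fun _ _ h => setoid_iff.1 h m) f

lemma ofExpr_surjective {X Y : Adjoined I} (f : X ⟶ Y) : ∃ p : Expr G X.obj Y.obj, ofExpr I p = f :=
  Quotient.exists_rep f

lemma hom_ext {X Y : Adjoined I} {f g : X ⟶ Y} (h : ∀ m, eval m f = eval m g) : f = g := by
  obtain ⟨p, rfl⟩ := ofExpr_surjective f
  obtain ⟨q, rfl⟩ := ofExpr_surjective g
  exact Quotient.sound h

@[simp] lemma eval_comp (m : M) {X Y Z : Adjoined I} (f : X ⟶ Y) (g : Y ⟶ Z) :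
    eval m (f ≫ g) = eval m f ≫ eval m g := by
  obtain ⟨p, rfl⟩ := ofExpr_surjective f
  obtain ⟨q, rfl⟩ := ofExpr_surjective g
  rfl

lemma comp_eq_comp {X Y Y' Z : Adjoined I} {f : X ⟶ Y} {g : Y ⟶ Z} {f' : X ⟶ Y'} {g' : Y' ⟶ Z}
    (h : ∀ m, eval m f ≫ eval m g = eval m f' ≫ eval m g') : f ≫ g = f' ≫ g' :=
  hom_ext fun m => by rw [eval_comp, eval_comp, h]

@[simp] lemma eval_id (m : M) (X : Adjoined I) : eval m (𝟙 X) = 𝟙 _ :=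
  (I m).functor.map_id X.obj

instance : Category (Adjoined I) where
  id_comp f := hom_ext fun m => by simp
  comp_id f := hom_ext fun m => by simp
  assoc f g h := hom_ext fun m => by simp

section Module

variable {X Y : Adjoined I}

-- The operations are given by expressions, so that evaluation respects them; their laws then
-- follow from the injectivity of the joint evaluation `evalAll`.
instance : Zero (X ⟶ Y) := ⟨ofExpr I (.of 0)⟩
instance : Add (X ⟶ Y) :=
  ⟨fun f g => Quotient.map₂ .add (fun _ _ h _ _ h' m =>
    congrArg₂ (· + ·) (setoid_iff.1 h m) (setoid_iff.1 h' m)) f g⟩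
instance : SMul k (X ⟶ Y) := ⟨fun r f => ofExpr I (.of (r • 𝟙 X.obj)) ≫ f⟩
instance : Neg (X ⟶ Y) := ⟨fun f => (-1 : k) • f⟩
instance : Sub (X ⟶ Y) := ⟨fun f g => f + -g⟩
instance : SMul ℕ (X ⟶ Y) := ⟨fun j f => (j : k) • f⟩
instance : SMul ℤ (X ⟶ Y) := ⟨fun j f => (j : k) • f⟩

@[simp] lemma eval_zero (m : M) : eval m (0 : X ⟶ Y) = 0 :=
  (I m).functor.map_zero _ _

@[simp] lemma eval_add (m : M) (f g : X ⟶ Y) : eval m (f + g) = eval m f + eval m g := by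
  obtain ⟨p, rfl⟩ := ofExpr_surjective f
  obtain ⟨q, rfl⟩ := ofExpr_surjective g
  rfl

@[simp] lemma eval_smul (m : M) (r : k) (f : X ⟶ Y) : eval m (r • f) = r • eval m f := by
  refine (eval_comp m _ _).trans ?_
  change (I m).functor.map (r • 𝟙 X.obj) ≫ eval m f = _
  rw [Functor.map_smul, CategoryTheory.Functor.map_id, Linear.smul_comp, Category.id_comp]

/-- The values of a morphism under all interpretations. -/
def evalAll (f : X ⟶ Y) (m : M) : (I m).functor.obj X.obj ⟶ (I m).functor.obj Y.obj := eval m f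

lemma evalAll_injective : Function.Injective (evalAll (I := I) (X := X) (Y := Y)) :=
  fun _ _ h => hom_ext (congrFun h)

instance : AddCommGroup (X ⟶ Y) :=
  evalAll_injective.addCommGroup _ (funext eval_zero) (fun f g => funext fun m => eval_add m f g)
    (fun f => funext fun m => (eval_smul m (-1 : k) f).trans (by simp [evalAll]))
    (fun f g => funext fun m => (eval_add m f ((-1 : k) • g)).trans (by
      simp [evalAll, sub_eq_add_neg]))
    (fun f j => funext fun m => (eval_smul m (j : k) f).trans (by
      rw [Nat.cast_smul_eq_nsmul]; rfl))
    (fun f j => funext fun m => (eval_smul m (j : k) f).trans (by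
      rw [Int.cast_smul_eq_zsmul]; rfl))

/-- The values of a morphism under all interpretations, as an additive map. -/
def evalAddHom : (X ⟶ Y) →+ ∀ m, ((I m).functor.obj X.obj ⟶ (I m).functor.obj Y.obj) where
  toFun := evalAll
  map_zero' := funext eval_zero
  map_add' f g := funext fun m => eval_add m f g

instance : Module k (X ⟶ Y) :=
  evalAll_injective.module k evalAddHom (fun r f => funext fun m => eval_smul m r f)

end Module

instance : Preadditive (Adjoined I) where
  add_comp _ _ _ f g h := hom_ext fun m => by
    simp only [eval_comp, eval_add, Preadditive.add_comp]
  comp_add _ _ _ f g h := hom_ext fun m => by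
    simp only [eval_comp, eval_add, Preadditive.comp_add]

instance : Linear k (Adjoined I) where
  smul_comp _ _ _ r f g := hom_ext fun m => by
    simp only [eval_comp, eval_smul, Linear.smul_comp]
  comp_smul _ _ _ f r g := hom_ext fun m => by
    simp only [eval_comp, eval_smul, Linear.comp_smul]

/-- The functor from `C` to the category with adjoined generators; it is the identity on objects. -/
def incl (I : M → Interp k G) : C ⥤ Adjoined I where
  obj X := ⟨X⟩
  map f := ofExpr I (.of f)
  map_id _ := rfl
  map_comp f g := hom_ext fun m => (I m).functor.map_comp f g

instance : (incl I).Additive where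
  map_add := hom_ext fun m => by rw [eval_add]; exact (I m).functor.map_add

instance : (incl I).Linear k where
  map_smul f r := hom_ext fun m => by rw [eval_smul]; exact (I m).functor.map_smul r f

/-- The extension of an interpretation to the category with adjoined generators. -/
def desc (I : M → Interp k G) (m : M) : Adjoined I ⥤ (I m).target.carrier where
  obj X := (I m).functor.obj X.obj
  map f := eval m f
  map_id := eval_id m
  map_comp := eval_comp m

instance desc_additive (m : M) : (desc I m).Additive where
  map_add := eval_add m _ _

instance desc_linear (m : M) : (desc I m).Linear k where
  map_smul f r := eval_smul m r f

/-- A family of morphisms that is natural with respect to the morphisms of `C` and to the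
generators is natural. -/
lemma naturality {D : Type*} [Category D] [Preadditive D] {H H' : Adjoined I ⥤ D}
    [H.Additive] [H'.Additive]
    (α : ∀ X : C, H.obj ⟨X⟩ ⟶ H'.obj ⟨X⟩)
    (hof : ∀ {X Y : C} (f : X ⟶ Y), H.map ((incl I).map f) ≫ α Y = α X ≫ H'.map ((incl I).map f))
    (hgen : ∀ {X Y : C} (g : G X Y),
      H.map (ofExpr I (.gen g)) ≫ α Y = α X ≫ H'.map (ofExpr I (.gen g)))
    {X Y : Adjoined I} (f : X ⟶ Y) : H.map f ≫ α Y.obj = α X.obj ≫ H'.map f := by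
  obtain ⟨p, rfl⟩ := ofExpr_surjective f
  have key : ∀ {X Y : C} (p : Expr G X Y),
      H.map (ofExpr I p) ≫ α Y = α X ≫ H'.map (ofExpr I p) := by
    intro X Y p
    induction p with
    | of f => exact hof f
    | gen g => exact hgen g
    | comp p q hp hq =>
      have : ofExpr I (p.comp q) = ofExpr I p ≫ ofExpr I q := rfl
      rw [this, H.map_comp, H'.map_comp, Category.assoc, hq, ← Category.assoc, hp, Category.assoc]
    | add p q hp hq =>
      have : ofExpr I (p.add q) = ofExpr I p + ofExpr I q := rfl
      rw [this, H.map_add, H'.map_add, Preadditive.add_comp, Preadditive.comp_add, hp, hq]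
  exact key p

/-- The functor between categories with adjoined generators that is induced by an assignment `Φ`,
`γ` of expressions to generators, if the interpretations of both categories are related by
isomorphisms `ν` that are compatible with this assignment. -/
def map {C' : Type v} [Category.{v} C'] [Preadditive C'] [Linear k C'] {G' : C' → C' → Type v}
    {I : M → Interp k G} {I' : M → Interp k G'} (Φ : C ⥤ C') [Φ.Additive]
    (γ : ∀ {X Y : C}, G X Y → Expr G' (Φ.obj X) (Φ.obj Y))
    (Ψ : ∀ m, (I m).target.carrier ⥤ (I' m).target.carrier) [∀ m, (Ψ m).Additive]
    (ν : ∀ m X, (I' m).functor.obj (Φ.obj X) ≅ (Ψ m).obj ((I m).functor.obj X))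
    (hof : ∀ m {X Y : C} (f : X ⟶ Y), (I' m).functor.map (Φ.map f) ≫ (ν m Y).hom =
      (ν m X).hom ≫ (Ψ m).map ((I m).functor.map f))
    (hgen : ∀ m {X Y : C} (g : G X Y), (I' m).eval (γ g) ≫ (ν m Y).hom =
      (ν m X).hom ≫ (Ψ m).map ((I m).gen g)) : Adjoined I ⥤ Adjoined I' where
  obj X := ⟨Φ.obj X.obj⟩
  -- The isomorphisms `ν` express the values of the image of `p` by the values of `p`.
  map f := Quotient.map (fun p => p.map Φ γ) (fun p q h m => (cancel_mono (ν m _).hom).1 <|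
    (Expr.eval_map_comp (fun X => (ν m X).hom) (hof m) (hgen m) p).trans <|
      (congrArg (fun φ => (ν m _).hom ≫ (Ψ m).map φ) (setoid_iff.1 h m)).trans
        (Expr.eval_map_comp (fun X => (ν m X).hom) (hof m) (hgen m) q).symm) f
  map_id X := by exact congrArg (incl I').map (Φ.map_id X.obj)
  map_comp f g := by
    obtain ⟨p, rfl⟩ := ofExpr_surjective f
    obtain ⟨q, rfl⟩ := ofExpr_surjective g
    rfl

section map

variable {C' : Type v} [Category.{v} C'] [Preadditive C'] [Linear k C'] {G' : C' → C' → Type v}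
    {I : M → Interp k G} {I' : M → Interp k G'} {Φ : C ⥤ C'} [Φ.Additive]
    {γ : ∀ {X Y : C}, G X Y → Expr G' (Φ.obj X) (Φ.obj Y)}
    {Ψ : ∀ m, (I m).target.carrier ⥤ (I' m).target.carrier} [∀ m, (Ψ m).Additive]
    {ν : ∀ m X, (I' m).functor.obj (Φ.obj X) ≅ (Ψ m).obj ((I m).functor.obj X)}
    {hof : ∀ m {X Y : C} (f : X ⟶ Y), (I' m).functor.map (Φ.map f) ≫ (ν m Y).hom =
      (ν m X).hom ≫ (Ψ m).map ((I m).functor.map f)}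
    {hgen : ∀ m {X Y : C} (g : G X Y), (I' m).eval (γ g) ≫ (ν m Y).hom =
      (ν m X).hom ≫ (Ψ m).map ((I m).gen g)}

lemma eval_map_map_comp (m : M) {X Y : Adjoined I} (f : X ⟶ Y) :
    eval m ((map Φ γ Ψ ν hof hgen).map f) ≫ (ν m Y.obj).hom =
      (ν m X.obj).hom ≫ (Ψ m).map (eval m f) := by
  obtain ⟨p, rfl⟩ := ofExpr_surjective f
  exact Expr.eval_map_comp (fun X => (ν m X).hom) (hof m) (hgen m) p

instance : (map Φ γ Ψ ν hof hgen).Additive where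
  map_add {_ _ f g} := by
    obtain ⟨p, rfl⟩ := ofExpr_surjective f
    obtain ⟨q, rfl⟩ := ofExpr_surjective g
    rfl

instance [Φ.Linear k] : (map Φ γ Ψ ν hof hgen).Linear k where
  map_smul {X Y} f r := ((map Φ γ Ψ ν hof hgen).map_comp _ _).trans <|
    congrArg (· ≫ (map Φ γ Ψ ν hof hgen).map f) <| congrArg (incl I').map <|
      show Φ.map (r • 𝟙 X.obj) = r • 𝟙 (Φ.obj X.obj) by
        rw [Functor.map_smul, CategoryTheory.Functor.map_id]

end map

end Adjoined

end Adjoined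

/-! ### Adjoining 2-morphisms to a birepresentation -/

section

variable {C : Type*} [Category C]

/-- Two adjacent commutative squares form a commutative rectangle. -/
lemma comp_squares {X X' X'' Y Y' Y'' : C} {a : X ⟶ Y} {a' : X' ⟶ Y'} {a'' : X'' ⟶ Y''}
    {p : X ⟶ X'} {p' : X' ⟶ X''} {q : Y ⟶ Y'} {q' : Y' ⟶ Y''} (h : a ≫ q = p ≫ a')
    (h' : a' ≫ q' = p' ≫ a'') : a ≫ q ≫ q' = (p ≫ p') ≫ a'' := by
  rw [← Category.assoc, h, Category.assoc, h', Category.assoc]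

/-- A face of a cube commutes if the other faces do and the edge `q'` is an isomorphism. -/
lemma eq_of_comp_squares {X X' Y Y' Z Z' W W' : C} {a : X ⟶ Y} {a' : X' ⟶ Y'} {b : Z ⟶ W}
    {b' : Z' ⟶ W'} {p : X ⟶ X'} {q : Y ⟶ Y'} {p' : Z ⟶ Z'} (q' : W ≅ W')
    {l : X ⟶ Z} {m : Y ⟶ W} {l' : X' ⟶ Z'} {m' : Y' ⟶ W'} (h : a ≫ q = p ≫ a')
    (hm : m ≫ q'.hom = q ≫ m') (h' : a' ≫ m' = l' ≫ b') (hl : l ≫ p' = p ≫ l')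
    (hb : b ≫ q'.hom = p' ≫ b') : a ≫ m = l ≫ b := by
  rw [← cancel_mono q'.hom, Category.assoc, Category.assoc, hm, hb, ← Category.assoc, h,
    Category.assoc, h', ← Category.assoc, ← hl, Category.assoc]

end

namespace LinRep

variable {𝔅 : Type*} [Bicategory 𝔅] [PreadditiveBicategory 𝔅] [LinearBicategory k 𝔅]

/-- Generators for new morphisms in the categories of the birepresentation `R`, together with a
family of models, that is, of strong transformations `leg m : R ⟶ target m` with images of
the generators. The action of a 1-morphism on a generator has to be given by an expression,
in a way that is correct in each model. -/
structure Presentation (R : LinRep.{u, v} k 𝔅) where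
  Model : Type w
  target : Model → LinRep.{u, v} k 𝔅
  leg : ∀ m, R ⟶ target m
  Gen : ∀ s, cat R s → cat R s → Type v
  gen : ∀ (m : Model) {s : 𝔅} {X Y : cat R s}, Gen s X Y →
    ((fn (leg m) s).obj X ⟶ (fn (leg m) s).obj Y)
  actGen : ∀ {s t : 𝔅} (F : s ⟶ t) {X Y : cat R s}, Gen s X Y →
    Expr (Gen t) ((act R F).obj X) ((act R F).obj Y)
  eval_actGen : ∀ (m : Model) {s t : 𝔅} (F : s ⟶ t) {X Y : cat R s} (g : Gen s X Y),
    (actGen F g).eval (fn (leg m) t) (gen m) ≫ (constraint (leg m) F Y).hom =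
      (constraint (leg m) F X).hom ≫ (act (target m) F).map (gen m g)

namespace Presentation

variable {R : LinRep.{u, v} k 𝔅} (P : Presentation.{u, v, w} R)

/-- The interpretations of the generators at the object `s` that are given by the models. -/
abbrev interp (s : 𝔅) (m : P.Model) : Interp k (P.Gen s) where
  target := (pseudo (P.target m)).obj s
  functor := fn (P.leg m) s
  gen := P.gen m

/-- The category of the presented birepresentation at the object `s`. -/
abbrev vertexCat (s : 𝔅) : LinCat.{u, v} k where
  carrier := Adjoined (P.interp s)

/-- The action of a 1-morphism on the presented birepresentation. -/
def vertexAct {s t : 𝔅} (F : s ⟶ t) : Adjoined (P.interp s) ⥤ Adjoined (P.interp t) :=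
  Adjoined.map (act R F) (P.actGen F) (fun m => act (P.target m) F)
    (fun m => constraint (P.leg m) F) (fun m => constraint_naturality (P.leg m) F)
    (fun m => P.eval_actGen m F)

instance {s t : 𝔅} (F : s ⟶ t) : (P.vertexAct F).Additive := by
  unfold vertexAct; infer_instance

instance {s t : 𝔅} (F : s ⟶ t) : (P.vertexAct F).Linear k := by
  unfold vertexAct; infer_instance

lemma eval_vertexAct_map (m : P.Model) {s t : 𝔅} (F : s ⟶ t) {X Y : Adjoined (P.interp s)}
    (f : X ⟶ Y) :
    Adjoined.eval m ((P.vertexAct F).map f) ≫ (constraint (P.leg m) F Y.obj).hom =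
      (constraint (P.leg m) F X.obj).hom ≫ (act (P.target m) F).map (Adjoined.eval m f) :=
  Adjoined.eval_map_map_comp m f

lemma vertexAct_naturality {s t : 𝔅} {F G : s ⟶ t} (η : F ⟶ G) {X Y : Adjoined (P.interp s)}
    (f : X ⟶ Y) :
    (P.vertexAct F).map f ≫ (Adjoined.incl (P.interp t)).map ((act₂ R η).app Y.obj) =
      (Adjoined.incl (P.interp t)).map ((act₂ R η).app X.obj) ≫ (P.vertexAct G).map f :=
  Adjoined.comp_eq_comp fun m =>
    eq_of_comp_squares (constraint (P.leg m) G Y.obj) (P.eval_vertexAct_map m F f)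
      (constraint_act₂ (P.leg m) η Y.obj)
      ((act₂ (P.target m) η).naturality (Adjoined.eval m f)) (constraint_act₂ (P.leg m) η X.obj)
      (P.eval_vertexAct_map m G f)

lemma vertexActId_naturality {s : 𝔅} {X Y : Adjoined (P.interp s)} (f : X ⟶ Y) :
    (P.vertexAct (𝟙 s)).map f ≫ (Adjoined.incl (P.interp s)).map (actId R s Y.obj).hom =
      (Adjoined.incl (P.interp s)).map (actId R s X.obj).hom ≫ f :=
  Adjoined.comp_eq_comp fun m =>
    eq_of_comp_squares (Iso.refl _) (P.eval_vertexAct_map m (𝟙 s) f)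
      ((Category.comp_id _).trans (constraint_id (P.leg m) Y.obj).symm)
      (actId_naturality (P.target m) (Adjoined.eval m f))
      ((Category.comp_id _).trans (constraint_id (P.leg m) X.obj).symm)
      ((Category.comp_id _).trans (Category.id_comp _).symm)

lemma eval_vertexAct_vertexAct_map (m : P.Model) {s t r : 𝔅} (F : s ⟶ t) (G : t ⟶ r)
    {X Y : Adjoined (P.interp s)} (f : X ⟶ Y) :
    Adjoined.eval m ((P.vertexAct G).map ((P.vertexAct F).map f)) ≫
        ((constraint (P.leg m) G ((act R F).obj Y.obj)) ≪≫
          (act (P.target m) G).mapIso (constraint (P.leg m) F Y.obj)).hom =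
      (constraint (P.leg m) G ((act R F).obj X.obj) ≪≫
          (act (P.target m) G).mapIso (constraint (P.leg m) F X.obj)).hom ≫
        (act (P.target m) G).map ((act (P.target m) F).map (Adjoined.eval m f)) :=
  comp_squares (P.eval_vertexAct_map m G ((P.vertexAct F).map f))
    (((act (P.target m) G).map_comp _ _).symm.trans <|
      (congrArg (act (P.target m) G).map (P.eval_vertexAct_map m F f)).trans
        ((act (P.target m) G).map_comp _ _))

lemma vertexActComp_naturality {s t r : 𝔅} (F : s ⟶ t) (G : t ⟶ r)
    {X Y : Adjoined (P.interp s)} (f : X ⟶ Y) :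
    (P.vertexAct (F ≫ G)).map f ≫
        (Adjoined.incl (P.interp r)).map (actComp R F G Y.obj).hom =
      (Adjoined.incl (P.interp r)).map (actComp R F G X.obj).hom ≫
        (P.vertexAct G).map ((P.vertexAct F).map f) :=
  Adjoined.comp_eq_comp fun m =>
    eq_of_comp_squares (constraint (P.leg m) G ((act R F).obj Y.obj) ≪≫
        (act (P.target m) G).mapIso (constraint (P.leg m) F Y.obj))
      (P.eval_vertexAct_map m (F ≫ G) f)
      (constraint_comp (P.leg m) F G Y.obj).symm
      (actComp_naturality (P.target m) F G (Adjoined.eval m f))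
      (constraint_comp (P.leg m) F G X.obj).symm
      (P.eval_vertexAct_vertexAct_map m F G f)

/-- The pseudofunctor of the presented birepresentation. Its constraints are the images of those
of `R`, from which it inherits the coherence laws. -/
def vertexPseudo : 𝔅 ⥤ᵖ LinCat.{u, v} k where
  obj s := P.vertexCat s
  map F := LinFunctor.mk (C := P.vertexCat _) (D := P.vertexCat _) (P.vertexAct F)
  map₂ η := LinFunctor.Hom.mk
    { app := fun X => (Adjoined.incl _).map ((act₂ R η).app X.obj)
      naturality := fun _ _ f => P.vertexAct_naturality η f }
  mapId s := LinCat.isoMk (NatIso.ofComponents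
    (fun X => (Adjoined.incl (P.interp s)).mapIso (actId R s X.obj))
    (fun f => P.vertexActId_naturality f))
  mapComp F G := LinCat.isoMk (NatIso.ofComponents
    (fun X => (Adjoined.incl (P.interp _)).mapIso (actComp R F G X.obj))
    (fun f => P.vertexActComp_naturality F G f))
  map₂_id F := LinCat.hom_ext fun X =>
    congrArg (Adjoined.incl _).map (act₂_id_app R F X.obj)
  map₂_comp η θ := LinCat.hom_ext fun X =>
    (congrArg (Adjoined.incl _).map (act₂_comp_app R η θ X.obj)).trans (Functor.map_comp _ _ _)
  map₂_whisker_left F _ _ η := LinCat.hom_ext fun X =>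
    (congrArg (Adjoined.incl _).map (act₂_whiskerLeft_app R F η X.obj)).trans <| by
      rw [Functor.map_comp, Functor.map_comp]; rfl
  map₂_whisker_right η H := LinCat.hom_ext fun X =>
    (congrArg (Adjoined.incl _).map (act₂_whiskerRight_app R η H X.obj)).trans <| by
      rw [Functor.map_comp, Functor.map_comp]; rfl
  map₂_associator F G H := LinCat.hom_ext fun X =>
    (congrArg (Adjoined.incl _).map (act₂_associator_app R F G H X.obj)).trans <| by
      rw [Functor.map_comp, Functor.map_comp, Functor.map_comp]
      exact congrArg (_ ≫ ·) (congrArg (_ ≫ ·) (Category.id_comp _).symm)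
  map₂_left_unitor F := LinCat.hom_ext fun X =>
    (congrArg (Adjoined.incl _).map (act₂_leftUnitor_app R F X.obj)).trans <| by
      rw [Functor.map_comp]
      exact congrArg (_ ≫ ·) (Category.comp_id _).symm
  map₂_right_unitor F := LinCat.hom_ext fun X =>
    (congrArg (Adjoined.incl _).map (act₂_rightUnitor_app R F X.obj)).trans <| by
      rw [Functor.map_comp]
      exact congrArg (_ ≫ ·) (Category.comp_id _).symm

/-- The presented birepresentation. -/
def vertex : LinRep.{u, v} k 𝔅 :=
  LinPseudofunctor.mk P.vertexPseudo
    (fun η θ => LinCat.hom_ext fun X =>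
      (congrArg (Adjoined.incl _).map (act₂_add_app R η θ X.obj)).trans (Functor.map_add _))
    (fun c η => LinCat.hom_ext fun X =>
      (congrArg (Adjoined.incl _).map (act₂_smul_app R c η X.obj)).trans (Functor.map_smul _ _ _))

/-- The strong transformation from `R` to the presented birepresentation. -/
def proj : R ⟶ P.vertex :=
  mkTrans (R := R) (R' := P.vertex) 
    (fun s => LinFunctor.mk (C := (pseudo R).obj s) (D := P.vertexCat s)
      (Adjoined.incl (P.interp s)))
    (fun {_ t} F => NatIso.ofComponents
      (fun X => Iso.refl ((Adjoined.incl (P.interp t)).obj ((act R F).obj X)))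
      (fun _ => (Category.comp_id _).trans (Category.id_comp _).symm))
    (fun _ _ => (Category.comp_id _).trans (Category.id_comp _).symm)
    (fun _ _ => Category.id_comp _)
    (fun _ G _ => (Category.id_comp _).trans <| Eq.symm <|
      (congrArg (_ ≫ ·) ((Category.id_comp _).trans ((P.vertexAct G).map_id _))).trans
        (Category.comp_id _))

/-- The strong transformation from the presented birepresentation that is given by a model. -/
def desc (m : P.Model) : P.vertex ⟶ P.target m :=
  mkTrans (R := P.vertex) (R' := P.target m) 
    (fun s => LinFunctor.mk (C := P.vertexCat s) (Adjoined.desc (P.interp s) m)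
      (additive := Adjoined.desc_additive m) (linear := Adjoined.desc_linear m))
    (fun F => NatIso.ofComponents (fun X => constraint (P.leg m) F X.obj)
      (fun f => P.eval_vertexAct_map m F f))
    (fun η X => constraint_act₂ (P.leg m) η X.obj)
    (fun _ X => constraint_id (P.leg m) X.obj)
    (fun F G X => constraint_comp (P.leg m) F G X.obj)

end Presentation

end LinRep

/-! ### Modifications out of a presented birepresentation -/

namespace LinRep

variable {𝔅 : Type*} [Bicategory 𝔅] [PreadditiveBicategory 𝔅] [LinearBicategory k 𝔅]

namespace Presentation

variable {R : LinRep.{u, v} k 𝔅} (P : Presentation.{u, v, w} R)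

/-- The strong transformation given by a model restricts to the leg of the model. -/
def projDescIso (m : P.Model) : P.proj ≫ P.desc m ≅ P.leg m :=
  mkCellIso (fun s => NatIso.ofComponents (fun X => Iso.refl ((fn (P.leg m) s).obj X))
      (fun _ => (Category.comp_id _).trans (Category.id_comp _).symm)) fun {_ t} F X =>
    (Category.id_comp _).trans <| Eq.symm <|
      (congrArg₂ (· ≫ ·) (constraint_comp_hom P.proj (P.desc m) F X)
        ((act (P.target m) F).map_id _)).trans <| (Category.comp_id _).trans <|
      (congrArg (· ≫ (constraint (P.leg m) F X).hom)
        ((fn (P.desc m) t).map_id ⟨(act R F).obj X⟩)).trans (Category.id_comp _)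

variable {P} {S : LinRep.{u, v} k 𝔅} {h h' : P.vertex ⟶ S}

lemma whiskerLeft_proj_injective {β β' : h ⟶ h'} (e : P.proj ◁ β = P.proj ◁ β') : β = β' :=
  cell_ext fun s X => congrArg (fun γ => (cell γ s).app X.obj) e

lemma constraint_proj_comp (h : P.vertex ⟶ S) {s t : 𝔅} (F : s ⟶ t) (X : cat R s) :
    (constraint (P.proj ≫ h) F X).hom =
      (constraint h F ((fn P.proj s).obj X)).hom :=
  (constraint_comp_hom P.proj h F X).trans <|
    (congrArg (· ≫ (constraint h F ((fn P.proj s).obj X)).hom)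
      ((fn h t).map_id ⟨(act R F).obj X⟩)).trans (Category.id_comp _)

/-- A modification between the restrictions to `R` of strong transformations from the presented
birepresentation extends if it is natural with respect to the generators. -/
lemma exists_whiskerLeft_proj (α : P.proj ≫ h ⟶ P.proj ≫ h')
    (hα : ∀ (s : 𝔅) {X Y : cat R s} (g : P.Gen s X Y),
      (fn h s).map (Adjoined.ofExpr (P.interp s) (.gen g)) ≫ (cell α s).app Y =
        (cell α s).app X ≫ (fn h' s).map (Adjoined.ofExpr (P.interp s) (.gen g))) :
    ∃ β : h ⟶ h', P.proj ◁ β = α :=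
  ⟨mkCell
    (fun s =>
      { app := fun X => (cell α s).app X.obj
        naturality := fun _ _ f =>
          -- `fn h s` and `fn h' s`, with the source in a form in which its structure is found.
          let H : Adjoined (P.interp s) ⥤ cat S s := fn h s
          let H' : Adjoined (P.interp s) ⥤ cat S s := fn h' s
          have : H.Additive := (h.hom.app s).additive
          have : H'.Additive := (h'.hom.app s).additive
          Adjoined.naturality (I := P.interp s) (H := H) (H' := H')
            (fun X => (cell α s).app X) (fun f => (cell α s).naturality f) (fun g => hα s g) f })
    (fun F X => by
      have := cell_constraint α F X.obj
      rw [constraint_proj_comp, constraint_proj_comp] at this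
      exact this),
    cell_ext fun s X => rfl⟩

end Presentation

/-! ### Coequifiers of birepresentations -/

section Coequifier

variable {ι : Type*} {a : ι → LinRep.{u, v} k 𝔅} {b : LinRep.{u, v} k 𝔅} {f g : ∀ i, a i ⟶ b}

/-- The presentation without generators whose models are all strong transformations that coequify
the given modifications. -/
def coequifierPresentation (α β : ∀ i, f i ⟶ g i) : Presentation b where
  Model := Σ d, (Coequifies α β d).FullSubcategory
  target m := m.1
  leg m := m.2.obj
  Gen _ _ _ := PEmpty
  gen _ _ _ _ := PEmpty.elim
  actGen _ _ _ := PEmpty.elim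
  eval_actGen _ _ _ _ _ _ g := g.elim

theorem exists_isCoequifier (α β : ∀ i, f i ⟶ g i) :
    ∃ (c : LinRep.{u, v} k 𝔅) (h : b ⟶ c), IsCoequifier α β h := by
  let P := coequifierPresentation α β
  have hP : Coequifies α β P.vertex P.proj := fun i => cell_ext fun s X =>
    Adjoined.hom_ext (I := P.interp s) fun m =>
      congrArg (fun γ => (cell γ s).app X) (m.2.property i)
  refine ⟨P.vertex, P.proj, hP, fun d => ?_⟩
  exact
    { faithful := ⟨fun e => Presentation.whiskerLeft_proj_injective
        (congrArg (Coequifies α β d).ι.map e)⟩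
      full := ⟨fun φ => by
        obtain ⟨β, hβ⟩ := Presentation.exists_whiskerLeft_proj φ.hom fun _ _ _ g => g.elim
        exact ⟨β, InducedCategory.hom_ext hβ⟩⟩
      essSurj := ⟨fun m => ⟨P.desc ⟨d, m⟩, ⟨ObjectProperty.isoMk _ (P.projDescIso ⟨d, m⟩)⟩⟩⟩ }

end Coequifier

end LinRep

/-! ### Iterated coisoinserters of birepresentations -/

namespace IsoCocone

variable {𝒦 : Type*} [Bicategory 𝒦] {a b : 𝒦} {ι : Type*} {f : ι → (a ⟶ b)} {r : Setoid ι}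

/-- An isomorphism of cocones with the same vertex from an isomorphism of their legs. -/
def isoMk {c : 𝒦} {x y : IsoCocone f r c} (e : x.leg ≅ y.leg)
    (h : ∀ {i j : ι} (h : r i j), (x.iso h).hom ≫ f j ◁ e.hom = f i ◁ e.hom ≫ (y.iso h).hom) :
    x ≅ y where
  hom := ⟨e.hom, h⟩
  inv := ⟨e.inv, fun {i j} hij => by
    rw [← cancel_mono (f j ◁ e.hom), Category.assoc, Category.assoc, h, whiskerLeft_inv_hom,
      Category.comp_id, whiskerLeft_inv_hom_assoc]⟩
  hom_inv_id := IsoCocone.hom_ext e.hom_inv_id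
  inv_hom_id := IsoCocone.hom_ext e.inv_hom_id

end IsoCocone

namespace LinRep

variable {𝔅 : Type*} [Bicategory 𝔅] [PreadditiveBicategory 𝔅] [LinearBicategory k 𝔅]
  {a b : LinRep.{u, v} k 𝔅} {ι : Type} (f : ι → (a ⟶ b)) (r : Setoid ι)

/-- The generators `f i A ⟶ f j A`, for `i` and `j` equivalent. -/
inductive CoinserterGen (s : 𝔅) : cat b s → cat b s → Type v
  | mk {i j : ι} (h : r i j) (A : cat a s) : CoinserterGen s ((fn (f i) s).obj A)
      ((fn (f j) s).obj A)

namespace CoinserterGen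

variable {f r}

/-- The images of the generators under a cocone are the components of its isomorphisms. -/
def eval {d : LinRep.{u, v} k 𝔅} (y : IsoCocone f r d) {s : 𝔅} {X Y : cat b s} :
    CoinserterGen f r s X Y → ((fn y.leg s).obj X ⟶ (fn y.leg s).obj Y)
  | mk h A => (cell (y.iso h).hom s).app A

/-- The action on the generators, which makes them the components of modifications. -/
def act {s t : 𝔅} (F : s ⟶ t) {X Y : cat b s} : CoinserterGen f r s X Y →
    Expr (CoinserterGen f r t) ((LinRep.act b F).obj X) ((LinRep.act b F).obj Y)
  | mk (i := i) (j := j) h A => .comp (.of (constraint (f i) F A).inv)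
      (.comp (.gen (mk h ((LinRep.act a F).obj A))) (.of (constraint (f j) F A).hom))

lemma eval_act {d : LinRep.{u, v} k 𝔅} (y : IsoCocone f r d) {s t : 𝔅} (F : s ⟶ t)
    {X Y : cat b s} (g : CoinserterGen f r s X Y) :
    (g.act F).eval (fn y.leg t) (eval y) ≫ (constraint y.leg F Y).hom =
      (constraint y.leg F X).hom ≫ (LinRep.act d F).map (eval y g) := by
  obtain ⟨h, A⟩ := g
  rename_i i j
  have e := cell_constraint (y.iso h).hom F A
  rw [constraint_comp_hom, constraint_comp_hom] at e
  refine (Category.assoc _ _ _).trans ?_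
  refine (congrArg (_ ≫ ·) ((Category.assoc _ _ _).trans (e.trans (Category.assoc _ _ _)))).trans ?_
  exact ((fn y.leg t).mapIso (constraint (f i) F A)).inv_hom_id_assoc _

end CoinserterGen

/-- The presentation with generators `f i A ⟶ f j A` whose models are all cocones. -/
def coinserterPresentation : Presentation b where
  Model := Σ d, IsoCocone f r d
  target m := m.1
  leg m := m.2.leg
  Gen s := CoinserterGen f r s
  gen m _ _ _ := CoinserterGen.eval m.2
  actGen F _ _ := CoinserterGen.act F
  eval_actGen m _ _ F _ _ := CoinserterGen.eval_act m.2 F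

/-- The component of the universal cocone at an object. -/
abbrev coinserterHom {i j : ι} (h : r i j) (s : 𝔅) (A : cat a s) :
    (fn (coinserterPresentation f r).proj s).obj ((fn (f i) s).obj A) ⟶
      (fn (coinserterPresentation f r).proj s).obj ((fn (f j) s).obj A) :=
  Adjoined.ofExpr ((coinserterPresentation f r).interp s) (.gen (.mk h A))

section

variable {f r}

lemma coinserterHom_comp {i j l : ι} (h : r i j) (h' : r j l) (s : 𝔅) (A : cat a s) :
    coinserterHom f r h s A ≫ coinserterHom f r h' s A = coinserterHom f r (r.trans h h') s A :=
  Adjoined.hom_ext (I := (coinserterPresentation f r).interp s) fun m =>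
    (Adjoined.eval_comp m _ _).trans
      (congrArg (fun γ => (cell (Iso.hom γ) s).app A) (m.2.iso_trans h h')).symm

lemma coinserterHom_refl (i : ι) (s : 𝔅) (A : cat a s) :
    coinserterHom f r (r.refl i) s A = 𝟙 _ :=
  Adjoined.hom_ext (I := (coinserterPresentation f r).interp s) fun m =>
    (congrArg (fun γ => (cell (Iso.hom γ) s).app A) (m.2.iso_refl i)).trans
      (Adjoined.eval_id m ((fn (coinserterPresentation f r).proj s).obj ((fn (f i) s).obj A))).symm

lemma coinserterHom_naturality {i j : ι} (h : r i j) (s : 𝔅) {A A' : cat a s} (φ : A ⟶ A') :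
    (fn (coinserterPresentation f r).proj s).map ((fn (f i) s).map φ) ≫
        coinserterHom f r h s A' =
      coinserterHom f r h s A ≫
        (fn (coinserterPresentation f r).proj s).map ((fn (f j) s).map φ) :=
  Adjoined.comp_eq_comp (I := (coinserterPresentation f r).interp s) fun m =>
    (cell (m.2.iso h).hom s).naturality φ

lemma act_map_coinserterHom {i j : ι} (h : r i j) {s t : 𝔅} (F : s ⟶ t) (A : cat a s) :
    (act (coinserterPresentation f r).vertex F).map (coinserterHom f r h s A) =
      (fn (coinserterPresentation f r).proj t).map (constraint (f i) F A).inv ≫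
        coinserterHom f r h t ((act a F).obj A) ≫
          (fn (coinserterPresentation f r).proj t).map (constraint (f j) F A).hom := rfl

end

/-- The universal cocone, with the generators as the components of its isomorphisms. -/
def coinserterCocone : IsoCocone f r (coinserterPresentation f r).vertex where
  leg := (coinserterPresentation f r).proj
  iso {i j} h := mkCellIso
    (fun s => NatIso.ofComponents
      (fun A =>
        { hom := coinserterHom f r h s A
          inv := coinserterHom f r (r.symm h) s A
          hom_inv_id := (coinserterHom_comp _ _ s A).trans (coinserterHom_refl i s A)
          inv_hom_id := (coinserterHom_comp _ _ s A).trans (coinserterHom_refl j s A) })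
      (coinserterHom_naturality h s))
    (fun {s t} F A => by
      have e (i : ι) : (constraint (f i ≫ (coinserterPresentation f r).proj) F A).hom =
          (fn (coinserterPresentation f r).proj t).map (constraint (f i) F A).hom :=
        (constraint_comp_hom _ _ F A).trans (Category.comp_id _)
      rw [e, e]
      refine Eq.trans ?_ (congrArg (_ ≫ ·) (act_map_coinserterHom h F A).symm)
      exact (((fn (coinserterPresentation f r).proj t).mapIso
        (constraint (f i) F A)).hom_inv_id_assoc _).symm)
  iso_refl i := Iso.ext <| cell_ext fun s A => coinserterHom_refl i s A
  iso_trans h h' := Iso.ext <| cell_ext fun s A => (coinserterHom_comp h h' s A).symm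

/-- The components of the isomorphisms of the cocone induced by `g`. -/
lemma cell_postcomp_iso {d : LinRep.{u, v} k 𝔅} {c : LinRep.{u, v} k 𝔅} (x : IsoCocone f r c)
    (g : c ⟶ d) {i j : ι} (h : r i j) (s : 𝔅) (A : cat a s) :
    (cell ((x.postcomp g).iso h).hom s).app A = (fn g s).map ((cell (x.iso h).hom s).app A) :=
  show 𝟙 _ ≫ (fn g s).map ((cell (x.iso h).hom s).app A) ≫ 𝟙 _ = _ by
    rw [Category.comp_id, Category.id_comp]

theorem isBicolimit_coinserterCocone : (coinserterCocone f r).IsBicolimit := fun d =>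
  { faithful := ⟨fun e => Presentation.whiskerLeft_proj_injective (congrArg IsoCocone.Hom.hom e)⟩
    full := ⟨fun {g g'} α => by
      obtain ⟨β, hβ⟩ := Presentation.exists_whiskerLeft_proj α.hom fun s X Y p => by
        obtain ⟨h, A⟩ := p
        have e := congrArg (fun γ => (cell γ s).app A) (α.comm h)
        have e' := cell_postcomp_iso f r (coinserterCocone f r) g h s A
        have e'' := cell_postcomp_iso f r (coinserterCocone f r) g' h s A
        exact ((congrArg (· ≫ _) e').symm.trans e).trans (congrArg (_ ≫ ·) e'')
      exact ⟨β, IsoCocone.hom_ext hβ⟩⟩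
    essSurj := ⟨fun y => ⟨(coinserterPresentation f r).desc ⟨d, y⟩,
      ⟨IsoCocone.isoMk ((coinserterPresentation f r).projDescIso ⟨d, y⟩) fun h =>
        cell_ext fun s A => by
          have e := cell_postcomp_iso f r (coinserterCocone f r)
            ((coinserterPresentation f r).desc ⟨d, y⟩) h s A
          exact (Category.comp_id _).trans (e.trans (Category.id_comp _).symm)⟩⟩⟩ }

end LinRep

/-! ### Cocones for varying equivalence relations -/

namespace IsoCocone

variable {𝒦 : Type*} [Bicategory 𝒦] {a b e : 𝒦} {ι : Type*} {f : ι → (a ⟶ b)} {r r' : Setoid ι}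

/-- The functor from cocones with vertex `c` to cocones with vertex `d` given by a 1-morphism. -/
def postcompFunctor (f : ι → (a ⟶ b)) (r : Setoid ι) {c d : 𝒦} (g : c ⟶ d) :
    IsoCocone f r c ⥤ IsoCocone f r d where
  obj x := x.postcomp g
  map {x y} α := ⟨α.hom ▷ g, fun {i j} h => by
    change ((α_ (f i) x.leg g).inv ≫ (x.iso h).hom ▷ g ≫ (α_ (f j) x.leg g).hom) ≫
        f j ◁ α.hom ▷ g =
      f i ◁ α.hom ▷ g ≫ (α_ (f i) y.leg g).inv ≫ (y.iso h).hom ▷ g ≫ (α_ (f j) y.leg g).hom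
    simp only [Category.assoc]
    rw [← associator_naturality_middle, ← comp_whiskerRight_assoc, α.comm h,
      comp_whiskerRight_assoc, associator_inv_naturality_middle_assoc]⟩
  map_id x := IsoCocone.hom_ext (id_whiskerRight _ _)
  map_comp α β := IsoCocone.hom_ext (comp_whiskerRight _ _ _)

/-- Iterated postcomposition is postcomposition with the composite. -/
def postcompPostcompIso {c c' d : 𝒦} (x : IsoCocone f r c) (g : c ⟶ c') (g' : c' ⟶ d) :
    (x.postcomp g).postcomp g' ≅ x.postcomp (g ≫ g') :=
  isoMk (α_ x.leg g g') fun {i j} h =>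
    show ((α_ (f i) (x.leg ≫ g) g').inv ≫ ((α_ (f i) x.leg g).inv ≫ (x.iso h).hom ▷ g ≫
          (α_ (f j) x.leg g).hom) ▷ g' ≫ (α_ (f j) (x.leg ≫ g) g').hom) ≫
        f j ◁ (α_ x.leg g g').hom =
      f i ◁ (α_ x.leg g g').hom ≫ (α_ (f i) x.leg (g ≫ g')).inv ≫ (x.iso h).hom ▷ (g ≫ g') ≫
        (α_ (f j) x.leg (g ≫ g')).hom by simp

/-- The isomorphism of legs underlying an isomorphism of cocones. -/
def legIso {c : 𝒦} {x y : IsoCocone f r c} (e : x ≅ y) : x.leg ≅ y.leg where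
  hom := e.hom.hom
  inv := e.inv.hom
  hom_inv_id := congrArg IsoCocone.Hom.hom e.hom_inv_id
  inv_hom_id := congrArg IsoCocone.Hom.hom e.inv_hom_id

/-- The restriction of cocones to a finer equivalence relation. -/
def restrict (f : ι → (a ⟶ b)) (h : r ≤ r') (c : 𝒦) : IsoCocone f r' c ⥤ IsoCocone f r c where
  obj x :=
    { leg := x.leg
      iso := fun hij => x.iso (h hij)
      iso_refl := x.iso_refl
      iso_trans := fun h₁ h₂ => x.iso_trans (h h₁) (h h₂) }
  map α := ⟨α.hom, fun hij => α.comm (h hij)⟩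

/-- If the cocones induced by `g`, `g'` and `g''` are the restrictions of given cocones for
successively coarser equivalence relations, then `g''` and `g ≫ g'` induce isomorphic cocones. -/
def postcompIsoOfRestrict {r'' : Setoid ι} {c c' c'' : 𝒦} {x : IsoCocone f r c}
    {x' : IsoCocone f r' c'} {x'' : IsoCocone f r'' c''} {h : r ≤ r'} {h' : r' ≤ r''}
    {h'' : r ≤ r''} {g : c ⟶ c'} {g' : c' ⟶ c''} {g'' : c ⟶ c''}
    (φ : x.postcomp g ≅ (restrict f h c').obj x')
    (φ' : x'.postcomp g' ≅ (restrict f h' c'').obj x'')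
    (φ'' : x.postcomp g'' ≅ (restrict f h'' c'').obj x'') :
    x.postcomp g'' ≅ x.postcomp (g ≫ g') :=
  let ψ : (restrict f h c'').obj (x'.postcomp g') ≅ (restrict f h'' c'').obj x'' :=
    (restrict f h c'').mapIso φ'
  let ψ' : (x.postcomp g).postcomp g' ≅ (restrict f h c'').obj (x'.postcomp g') :=
    (postcompFunctor f r g').mapIso φ
  φ'' ≪≫ ψ.symm ≪≫ ψ'.symm ≪≫ postcompPostcompIso x g g'

/-- The cocone `x` is compatible with the 2-morphisms `σ i j` if these become the restrictions
of the isomorphisms of `x`. -/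
def Compatible {u : e ⟶ a} (σ : ∀ i j, u ≫ f i ⟶ u ≫ f j) {c : 𝒦} (x : IsoCocone f r c) : Prop :=
  ∀ {i j : ι} (h : r i j), u ◁ (x.iso h).hom =
    (α_ u (f i) x.leg).inv ≫ σ i j ▷ x.leg ≫ (α_ u (f j) x.leg).hom

section

variable {u : e ⟶ a} {σ : ∀ i j, u ≫ f i ⟶ u ≫ f j} {c d : 𝒦}

lemma Compatible.restrict {x : IsoCocone f r' c} (hx : x.Compatible σ) (h : r ≤ r') :
    ((restrict f h c).obj x).Compatible σ :=
  fun hij => hx (h hij)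

lemma Compatible.of_iso {x y : IsoCocone f r c} (φ : x ≅ y) (hy : y.Compatible σ) :
    x.Compatible σ := fun {i j} h => by
  have hinv : φ.hom.hom ≫ φ.inv.hom = 𝟙 x.leg := (legIso φ).hom_inv_id
  have key : (x.iso h).hom = f i ◁ φ.hom.hom ≫ (y.iso h).hom ≫ f j ◁ φ.inv.hom := by
    rw [← Category.assoc, ← φ.hom.comm h, Category.assoc, ← whiskerLeft_comp, hinv]
    simp
  rw [key, whiskerLeft_comp, whiskerLeft_comp, hy h]
  simp only [Category.assoc]
  rw [← associator_naturality_right, ← whisker_exchange_assoc,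
    associator_inv_naturality_right_assoc, ← whiskerLeft_comp_assoc, hinv]
  simp

/-- A cocone induced by `g` is compatible with `σ` if and only if `g` coequifies the 2-morphisms
that express the compatibility. -/
lemma compatible_postcomp_iff (x : IsoCocone f r c) (g : c ⟶ d) {i j : ι} (h : r i j) :
    u ◁ ((x.postcomp g).iso h).hom =
        (α_ u (f i) (x.leg ≫ g)).inv ≫ σ i j ▷ (x.leg ≫ g) ≫ (α_ u (f j) (x.leg ≫ g)).hom ↔
      (u ◁ (x.iso h).hom) ▷ g =
        ((α_ u (f i) x.leg).inv ≫ σ i j ▷ x.leg ≫ (α_ u (f j) x.leg).hom) ▷ g := by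
  have h₁ : u ◁ ((x.postcomp g).iso h).hom = (u ◁ (α_ (f i) x.leg g).inv ≫
      (α_ u (f i ≫ x.leg) g).inv) ≫ (u ◁ (x.iso h).hom) ▷ g ≫ (α_ u (f j ≫ x.leg) g).hom ≫
        u ◁ (α_ (f j) x.leg g).hom :=
    show u ◁ ((α_ (f i) x.leg g).inv ≫ (x.iso h).hom ▷ g ≫ (α_ (f j) x.leg g).hom) = _ by simp
  have h₂ : (α_ u (f i) (x.leg ≫ g)).inv ≫ σ i j ▷ (x.leg ≫ g) ≫ (α_ u (f j) (x.leg ≫ g)).hom =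
      (u ◁ (α_ (f i) x.leg g).inv ≫ (α_ u (f i ≫ x.leg) g).inv) ≫
        ((α_ u (f i) x.leg).inv ≫ σ i j ▷ x.leg ≫ (α_ u (f j) x.leg).hom) ▷ g ≫
          (α_ u (f j ≫ x.leg) g).hom ≫ u ◁ (α_ (f j) x.leg g).hom := by
    simp
  exact (Eq.congr h₁ h₂).trans ((cancel_epi _).trans (cancel_mono _))

end

end IsoCocone

/-! ### The colimits for varying set partitions -/

namespace WRColimit

open IsoCocone StarBirep

variable {k : Type u} [Field k] {n : ℕ} {𝔓 𝔓' : Setoid (Fin n)}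

theorem nonempty (𝔓 : Setoid (Fin n)) : Nonempty (WRColimit k n 𝔓) := by
  let x := LinRep.coinserterCocone (theta k (n := n)) 𝔓
  obtain ⟨c, h, hh⟩ := LinRep.exists_isCoequifier (ι := {p : Fin n × Fin n // 𝔓 p.1 p.2})
    (a := fun _ => repN k n)
    (f := fun p => incl k n ≫ theta k p.1.1 ≫ x.leg)
    (g := fun p => incl k n ≫ theta k p.1.2 ≫ x.leg)
    (fun p => incl k n ◁ (x.iso p.2).hom)
    (fun p => (α_ (incl k n) (theta k p.1.1) x.leg).inv ≫
      modif k p.1.1 p.1.2 ▷ x.leg ≫ (α_ (incl k n) (theta k p.1.2) x.leg).hom)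
  exact ⟨{
    CW := _
    cocone := x
    isBicolimit := LinRep.isBicolimit_coinserterCocone (theta k) 𝔓
    CWR := c
    ΩR := h
    isCoequifier := hh }⟩

variable (X : WRColimit k n 𝔓) {D : LinRep.{u, u + 1} k (Bicat k n)}

/-- The cocone with vertex `C^WR(𝔓)`. -/
noncomputable def coconeWR : IsoCocone (theta k) 𝔓 X.CWR := X.cocone.postcomp X.ΩR

lemma compatible_coconeWR : X.coconeWR.Compatible (modif k) := fun h =>
  (compatible_postcomp_iff X.cocone X.ΩR h).2 (X.isCoequifier.coequifies ⟨(_, _), h⟩)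

/-- The comparison functor of the cocone with vertex `C^WR(𝔓)` reaches every compatible cocone. -/
lemma exists_postcomp_iso (y : IsoCocone (theta k) 𝔓 D) (hy : y.Compatible (modif k)) :
    ∃ g : X.CWR ⟶ D, Nonempty (X.coconeWR.postcomp g ≅ y) := by
  have := X.isBicolimit D
  have := X.isCoequifier.isEquivalence D
  let φ : X.cocone.postcomp _ ≅ y := (X.cocone.comparison D).objObjPreimageIso y
  have hg := fun p : {p : Fin n × Fin n // 𝔓 p.1 p.2} =>
    (compatible_postcomp_iff X.cocone _ p.2).1 (hy.of_iso φ p.2)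
  let ψ := (coequifierComparison X.ΩR X.isCoequifier.coequifies D).objObjPreimageIso ⟨_, hg⟩
  exact ⟨_, ⟨postcompPostcompIso _ _ _ ≪≫
    (X.cocone.comparison D).mapIso ((Coequifies _ _ D).ι.mapIso ψ) ≪≫ φ⟩⟩

/-- The comparison functor of the cocone with vertex `C^WR(𝔓)` reflects isomorphism, as it is fully
faithful. -/
lemma nonempty_iso {g g' : X.CWR ⟶ D} (φ : X.coconeWR.postcomp g ≅ X.coconeWR.postcomp g') :
    Nonempty (g ≅ g') := by
  have := X.isBicolimit D
  have := X.isCoequifier.isEquivalence D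
  let ψ : X.ΩR ≫ g ≅ X.ΩR ≫ g' := (X.cocone.comparison D).preimageIso
    ((postcompPostcompIso X.cocone X.ΩR g).symm ≪≫ φ ≪≫ postcompPostcompIso X.cocone X.ΩR g')
  exact ⟨(coequifierComparison X.ΩR X.isCoequifier.coequifies D).preimageIso
    (ObjectProperty.isoMk _ ψ)⟩

end WRColimit

end BiRep

theorem mainTheorem10 (k : Type u) [Field k] [IsAlgClosed k] [CharZero k] (n : ℕ) (hn : 0 < n) :
    (∀ 𝔓 : Setoid (Fin n), Nonempty (BiRep.WRColimit k n 𝔓)) ∧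
    ∀ X : ∀ 𝔓 : Setoid (Fin n), BiRep.WRColimit k n 𝔓,
      ∃ Ω : ∀ 𝔓 𝔓' : Setoid (Fin n), 𝔓 ≤ 𝔓' → ((X 𝔓).CWR ⟶ (X 𝔓').CWR),
        (∀ (𝔓 𝔓' : Setoid (Fin n)) (h : 𝔓 ≤ 𝔓'),
          Nonempty ((X 𝔓').ΩWR ≅ (X 𝔓).ΩWR ≫ Ω 𝔓 𝔓' h)) ∧
        ∀ (𝔓 𝔓' 𝔓'' : Setoid (Fin n)) (h : 𝔓 ≤ 𝔓') (h' : 𝔓' ≤ 𝔓''),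
          Nonempty (Ω 𝔓 𝔓'' (h.trans h') ≅ Ω 𝔓 𝔓' h ≫ Ω 𝔓' 𝔓'' h') := by
  refine ⟨BiRep.WRColimit.nonempty, fun X => ?_⟩
  have H (𝔓 𝔓' : Setoid (Fin n)) (h : 𝔓 ≤ 𝔓') := (X 𝔓).exists_postcomp_iso
    ((BiRep.IsoCocone.restrict _ h _).obj (X 𝔓').coconeWR)
    (BiRep.IsoCocone.Compatible.restrict (X 𝔓').compatible_coconeWR h)
  choose Ω hΩ using H
  exact ⟨Ω, fun 𝔓 𝔓' h => (hΩ 𝔓 𝔓' h).map fun φ => (BiRep.IsoCocone.legIso φ).symm,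
    fun 𝔓 𝔓' 𝔓'' h h' => (X 𝔓).nonempty_iso (BiRep.IsoCocone.postcompIsoOfRestrict
      (hΩ 𝔓 𝔓' h).some (hΩ 𝔓' 𝔓'' h').some (hΩ 𝔓 𝔓'' (h.trans h')).some)⟩
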